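/- **Setting.** Let $\mathcal X,\mathcal S,\mathcal Y$ be finite sets, $W:\mathcal X\times\mathcal S\to\mathcal Y$ a function, $\lambda_{\mathbf x}\subseteq\Delta(\mathcal X)$ a set of admissible input distributions and $\lambda_{\mathbf s}\subseteq\Delta(\mathcal S)$ a convex set of admissible noise distributions which is nonempty and has nonempty interior relative to the smallest face of the simplex $\Delta(\mathcal S)$ containing it. This data is the adversarial channel $\mathcal A$. The type $\tau_{x}$ of a word $x\in\mathcal X^n$ is its empirical distribution, and the joint type $\tau_{x_1,\dots,x_L}\in\Delta(\mathcal X^L)$ of $L$ words is the type of the word of $L$-tuples $(x_1(j),\dots,x_L(j))_{j\le n}$. A code of blocklength $n$ for $\mathcal A$ is a set $\mathcal C\subseteq\Lambda_{\mathbf x}^{(n)}:=\{x\in\mathcal X^n:\tau_x\in\lambda_{\mathbf x}\}$; its rate is $R(\mathcal C)=\frac1n\log_2|\mathcal C|$ (and $0$ if $\mathcal C=\emptyset$). Fix $L\ge2$. Words $x_1,\dots,x_L\in\mathcal X^n$ are *confusable* if there are $y\in\mathcal Y^n$ and $s_1,\dots,s_L\in\mathcal S^n$ with $\tau_{s_i}\in\lambda_{\mathbf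 s}$ and $W(x_i(j),s_i(j))=y(j)$ for all $i,j$. A set $\mathcal C\subseteq\mathcal X^n$ is *$(L-1)$-list decodable* if no $L$ distinct elements of it are confusable. The $(L-1)$-list decoding capacity is $\limsup_{n\to\infty}\max R(\mathcal C)$, the maximum being over $(L-1)$-list decodable $\mathcal C\subseteq\Lambda_{\mathbf x}^{(n)}$. For $P_{\mathbf x}\in\Delta(\mathcal X)$ let $\mathcal J^{\otimes L}(P_{\mathbf x})$ be the set of all $P\in\Delta(\mathcal X^L)$ all of whose $L$ one-dimensional marginals equal $P_{\mathbf x}$ (the $(P_{\mathbf x},L)$-self-couplings); let $\mathrm{CP}^{\otimes L}(P_{\mathbf x})$ be the set of those of the form $\sum_{j=1}^r p_j^{\otimes L}$ with $p_j\in\mathbb R_{\ge0}^{\mathcal X}$; and let $\mathcal K^{\otimes L}(P_{\mathbf x})$ be the set of those $P\in\mathcal J^{\otimes L}(P_{\mathbf x})$ that are the law of $(\mathbf x_1,\dots,\mathbf x_L)$ for some random variables $(\mathbf x_1,\dots,\mathbf x_L,\mathbf s_1,\dots,\mathbf s_L,\mathbf y)$ in $\mathcal X^L\times\mathcal S^L\times\mathcal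 Y$ such that, for each $i$, the law of $\mathbf s_i$ lies in $\lambda_{\mathbf s}$ and $\mathbf y=W(\mathbf x_i,\mathbf s_i)$ almost surely. For $P\in\Delta(\mathcal X^L)$ and $\zeta>0$, a set $\mathcal C\subseteq\mathcal X^n$ is *$(\zeta,P)$-equicoupled* if it has an enumeration $x_1,\dots,x_{|\mathcal C|}$ with $\|\tau_{x_{i_1},\dots,x_{i_L}}-P\|_{1}\le\zeta$ for all $i_1<\dots<i_L$, where $\|\cdot\|_1$ is the sum of the absolute values of the entries. **Theorem (Converse).** Suppose that $\mathrm{CP}^{\otimes L}(P_{\mathbf x})\subseteq\mathcal K^{\otimes L}(P_{\mathbf x})$ for every $P_{\mathbf x}\in\lambda_{\mathbf x}$. Then: 1. The $(L-1)$-list decoding capacity of $\mathcal A$ is $0$. 2. For every $P_{\mathbf x}\in\lambda_{\mathbf x}$ and every $P\in\mathcal J^{\otimes L}(P_{\mathbf x})\setminus\mathcal K^{\otimes L}(P_{\mathbf x})$ there are $\zeta>0$ and $N\in\mathbb N$ such that, for every $n$, every $(\zeta,P)$-equicoupled $(L-1)$-list decodable code $\mathcal C\subseteq\mathcal X^n$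 has $|\mathcal C|\le N$. 3. If moreover, for some $P_{\mathbf x}\in\lambda_{\mathbf x}$, the $\|\cdot\|_1$-distance between $\mathrm{CP}^{\otimes L}(P_{\mathbf x})$ and $\mathcal J^{\otimes L}(P_{\mathbf x})\setminus\mathcal K^{\otimes L}(P_{\mathbf x})$ is positive, or the latter set is empty, then $\zeta$ and $N$ in 2. can be chosen to be the same for all $P\in\mathcal J^{\otimes L}(P_{\mathbf x})\setminus\mathcal K^{\otimes L}(P_{\mathbf x})$. -/

import Mathlib

open Finset Filter

namespace ListDecoding

noncomputable section

/-- The `ℓ¹` ("sum-absolute-value") norm of a real array. -/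
def savNorm {α : Type*} [Fintype α] (T : α → ℝ) : ℝ := ∑ a, |T a|

/-- The law of `f` under the (finitely supported) law `P`: `b ↦ ∑_{a : f a = b} P a`. -/
def marginal {α β : Type*} [Fintype α] (f : α → β) (P : α → ℝ) : β → ℝ := by
  classical exact fun b => ∑ a ∈ Finset.univ.filter (fun a => f a = b), P a

/-- The type (empirical distribution) of a word of length `n` over the alphabet `α`. -/
def empType {α : Type*} {n : ℕ} (x : Fin n → α) : α → ℝ := by
  classical exact fun a => ((Finset.univ.filter (fun j => x j = a)).card : ℝ) / (n : ℝ)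

/-- The joint type of `L` words of length `n`: the type of the word of columns,
a tensor of order `L` indexed by the alphabet. -/
def jointType {α : Type*} {L n : ℕ} (v : Fin L → Fin n → α) : (Fin L → α) → ℝ :=
  empType (fun j => fun i => v i j)

/-- Completely positive tensors of order `L`: sums `∑ j, p_j^{⊗L}` with `p_j` entrywise
nonnegative. -/
def IsCP {α : Type*} {L : ℕ} (T : (Fin L → α) → ℝ) : Prop :=
  ∃ r : ℕ, 1 ≤ r ∧ ∃ p : Fin r → α → ℝ, (∀ j a, 0 ≤ p j a) ∧
    ∀ x : Fin L → α, T x = ∑ j, ∏ i, p j (x i)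

/-- The set of `(Px, L)`-self-couplings. -/
def selfCouplings {α : Type*} [Fintype α] (L : ℕ) (Px : α → ℝ) : Set ((Fin L → α) → ℝ) :=
  {P | P ∈ stdSimplex ℝ (Fin L → α) ∧ ∀ i : Fin L, marginal (fun x => x i) P = Px}

/-- The set of completely positive `(Px, L)`-self-couplings. -/
def cpSelfCouplings {α : Type*} [Fintype α] (L : ℕ) (Px : α → ℝ) : Set ((Fin L → α) → ℝ) :=
  {P | P ∈ selfCouplings L Px ∧ IsCP P}

/-- `Q`, a set of distributions on `α`, has nonempty interior relative to the smallest face of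
the simplex that contains it: some `q ∈ Q` has the largest support among members of `Q`, and all
distributions close to `q` whose support lies in that of `q` belong to `Q`. -/
def HasInteriorInFace {α : Type*} [Fintype α] (Q : Set (α → ℝ)) : Prop :=
  ∃ q ∈ Q, (∀ p ∈ Q, ∀ a, q a = 0 → p a = 0) ∧
    ∃ ε : ℝ, 0 < ε ∧ ∀ p ∈ stdSimplex ℝ α, (∀ a, q a = 0 → p a = 0) →
      (∀ a, |p a - q a| ≤ ε) → p ∈ Q

/-- An adversarial channel with deterministic channel function `W`. The constraint sets are sets
of distributions; at blocklength `n` they constrain the types of the words (see `inputWords` and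
`noiseWords`). -/
structure Channel (X S Y : Type*) [Fintype X] [Fintype S] where
  /-- admissible input distributions -/
  inp : Set (X → ℝ)
  inp_subset : inp ⊆ stdSimplex ℝ X
  /-- admissible noise distributions -/
  noise : Set (S → ℝ)
  noise_subset : noise ⊆ stdSimplex ℝ S
  noise_convex : Convex ℝ noise
  /-- the channel function -/
  W : X → S → Y

namespace Channel

variable {X S Y : Type*} [Fintype X] [Fintype S]

/-- Words of length `n` of admissible input type. -/
def inputWords (A : Channel X S Y) (n : ℕ) : Set (Fin n → X) := {x | empType x ∈ A.inp}

/-- Noise words of length `n` of admissible type. -/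
def noiseWords (A : Channel X S Y) (n : ℕ) : Set (Fin n → S) := {s | empType s ∈ A.noise}

/-- The degenerate transition law `W(y | x, s) ∈ {0, 1}`. -/
def law (A : Channel X S Y) (y : Y) (x : X) (s : S) : ℝ := by
  classical exact if A.W x s = y then 1 else 0

/-- Confusability of a tuple of words: admissible noise words can bring all of them to one
common output word. -/
def ConfusableWords (A : Channel X S Y) {L n : ℕ} (v : Fin L → Fin n → X) : Prop :=
  ∃ (y : Fin n → Y) (s : Fin L → Fin n → S),
    ∀ i, s i ∈ A.noiseWords n ∧ ∀ j, A.W (v i j) (s i j) = y j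

/-- `(L-1)`-list decodability: no `L` distinct codewords are confusable. -/
def IsListDecodable (A : Channel X S Y) (L : ℕ) {n : ℕ} (C : Finset (Fin n → X)) : Prop :=
  ∀ v : Fin L → Fin n → X, Function.Injective v → (∀ i, v i ∈ C) → ¬ A.ConfusableWords v

/-- Confusability of a joint distribution: it extends to a joint law `E` of
`(x_1, …, x_L, s_1, …, s_L, y)` such that every `s_i` has an admissible law and `y` is obtained
from each `(x_i, s_i)` by the channel. -/
def ConfusableDistr (A : Channel X S Y) [Fintype Y] {L : ℕ} (P : (Fin L → X) → ℝ) : Prop :=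
  ∃ E ∈ stdSimplex ℝ ((Fin L → X) × (Fin L → S) × Y),
    marginal (fun e => e.1) E = P ∧
    (∀ i, marginal (fun e => e.2.1 i) E ∈ A.noise) ∧
    ∀ i x s y, marginal (fun e => (e.1 i, e.2.1 i, e.2.2)) E (x, s, y) =
      marginal (fun e => (e.1 i, e.2.1 i)) E (x, s) * A.law y x s

/-- The order-`L` confusability set at the input distribution `Px`. -/
def confusabilitySet (A : Channel X S Y) [Fintype Y] (L : ℕ) (Px : X → ℝ) :
    Set ((Fin L → X) → ℝ) :=
  {P | P ∈ selfCouplings L Px ∧ A.ConfusableDistr P}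

end Channel

/-- The rate `(log₂ |C|) / n` of a code of blocklength `n` (the empty code gets rate `0`). -/
def rate {X : Type*} {n : ℕ} (C : Finset (Fin n → X)) : ℝ :=
  Real.logb 2 (C.card : ℝ) / (n : ℝ)

/-- The `(L-1)`-list decoding capacity: the limit superior, as `n → ∞`, of the largest rate of an
`(L-1)`-list decodable code of blocklength `n` all of whose words are admissible inputs. For
finite `X` the supremum is over a finite family of codes (containing the empty one, if `1 ≤ L`),
with all rates in `[0, log₂ |X|]`. -/
def Channel.capacity {X S Y : Type*} [Fintype X] [Fintype S] (A : Channel X S Y) (L : ℕ) : ℝ :=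
  limsup (fun n : ℕ =>
    ⨆ C : {C : Finset (Fin n → X) // (↑C : Set (Fin n → X)) ⊆ A.inputWords n ∧
        A.IsListDecodable L C}, rate C.1) atTop

/-- `C` is `(ζ, P)`-equicoupled: for some enumeration of `C`, the joint types of all `L`-tuples
of codewords with increasing indices are within `ζ` of `P` in the sum-absolute-value norm. -/
def IsEquicoupled {X : Type*} [Fintype X] {L n : ℕ} (ζ : ℝ) (P : (Fin L → X) → ℝ)
    (C : Finset (Fin n → X)) : Prop :=
  ∃ c : Fin C.card ≃ {x // x ∈ C}, ∀ t : Fin L → Fin C.card, StrictMono t →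
    savNorm (fun x => jointType (fun i => (c (t i)).1) x - P x) ≤ ζ

end

end ListDecoding

/-! Everything rests on one fact about long sequences of words. If all increasing `L`-tuples of a
sequence have nearly the same joint type `P`, then for each letter `x` the indicator vectors of `x`
in these words have nearly constant pairwise correlations. So their averages over two disjoint long
blocks of words are close in mean square (`sum_sq_le_of_nearly_constant_gram`). Averaging joint
types over tuples with one word from each of `L` blocks shows that `P` is nearly the position
average of products of `L` block laws. Replacing each block law by that of the first block turns
this into a mixture of tensor powers (`abs_sub_columnMixture_le`). No symmetry of `P` is needed.

Mixtures of tensor powers of distributions form a compact set of completely positive tensors. A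
self-coupling outside the confusability set is not completely positive, hence has positive distance
from this compact set, and this bounds the size of equicoupled codes. A compact family of couplings
gives a uniform bound (`exists_card_bound_of_equicoupled`).

For the capacity, Ramsey's theorem extracts such a sequence from any large code of constant type,
and its column mixture is confusable by hypothesis. This alone does not suffice: noise words realise
a noise law only approximately, and that law may lie on the boundary of the constraint set. A code
of positive rate, however, has a large subcode whose words agree on a fraction `1 / m` of the
occurrences of each letter, because such restrictions are few. The mixture is then `1 / m` times a
diagonal law plus a multiple of a completely positive self-coupling (`exists_columnMixture_eq`). On
the diagonal part all words can receive the same noise, of relatively interior law `q`. This moves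
every noise law inwards by a fixed amount, which absorbs the errors (`confusableWords_of_near`). -/

namespace ListDecoding

noncomputable section

/-! ### Marginals and the sum norm. -/

section Marginals

variable {α β : Type*} [Fintype α]

theorem marginal_apply [DecidableEq β] (f : α → β) (P : α → ℝ) (b : β) :
    marginal f P b = ∑ a, if f a = b then P a else 0 := by
  classical
  simp only [marginal, Finset.sum_filter]
  exact Finset.sum_congr rfl fun a _ => by congr

theorem marginal_nonneg (f : α → β) {P : α → ℝ} (hP : ∀ a, 0 ≤ P a) (b : β) :
    0 ≤ marginal f P b := by
  classical
  rw [marginal_apply]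
  exact Finset.sum_nonneg fun a _ => by split_ifs <;> simp [hP a]

theorem sum_mul_marginal [Fintype β] (f : α → β) (P : α → ℝ) (g : β → ℝ) :
    ∑ b, marginal f P b * g b = ∑ a, P a * g (f a) := by
  classical
  simp only [marginal_apply, Finset.sum_mul]
  rw [Finset.sum_comm]
  exact Finset.sum_congr rfl fun a _ => by simp [ite_mul]

theorem sum_marginal [Fintype β] (f : α → β) (P : α → ℝ) :
    ∑ b, marginal f P b = ∑ a, P a := by
  simpa using sum_mul_marginal f P fun _ => 1

theorem marginal_add (f : α → β) (P Q : α → ℝ) :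
    marginal f (P + Q) = marginal f P + marginal f Q := by
  classical
  ext b
  simp only [marginal_apply, Pi.add_apply, ← Finset.sum_add_distrib]
  exact Finset.sum_congr rfl fun a _ => by split_ifs <;> simp

theorem marginal_smul (f : α → β) (c : ℝ) (P : α → ℝ) :
    marginal f (c • P) = c • marginal f P := by
  classical
  ext b
  simp only [marginal_apply, Pi.smul_apply, smul_eq_mul, Finset.mul_sum]
  exact Finset.sum_congr rfl fun a _ => by split_ifs <;> simp

theorem marginal_sum {ι : Type*} (f : α → β) (s : Finset ι) (P : ι → α → ℝ) :
    marginal f (∑ i ∈ s, P i) = ∑ i ∈ s, marginal f (P i) := by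
  classical
  induction s using Finset.induction_on with
  | empty => ext b; simp [marginal_apply]
  | insert i s hi ih => rw [Finset.sum_insert hi, Finset.sum_insert hi, marginal_add, ih]

theorem le_marginal (f : α → β) {P : α → ℝ} (hP : ∀ a, 0 ≤ P a) (a : α) :
    P a ≤ marginal f P (f a) := by
  classical
  rw [marginal_apply]
  have := Finset.single_le_sum (f := fun a' => if f a' = f a then P a' else 0)
    (fun a' _ => by split_ifs <;> simp [hP a']) (Finset.mem_univ a)
  simpa using this

theorem abs_le_savNorm (T : α → ℝ) (a : α) : |T a| ≤ savNorm T :=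
  Finset.single_le_sum (f := fun a => |T a|) (fun _ _ => abs_nonneg _) (Finset.mem_univ a)

theorem abs_sum_mul_le_savNorm (T g : α → ℝ) (hg : ∀ a, |g a| ≤ 1) :
    |∑ a, T a * g a| ≤ savNorm T := by
  refine (Finset.abs_sum_le_sum_abs _ _).trans (Finset.sum_le_sum fun a _ => ?_)
  rw [abs_mul]
  exact mul_le_of_le_one_right (abs_nonneg _) (hg a)

end Marginals

/-! ### Types as averages over positions. -/

section EmpiricalTypes

variable {α : Type*}

theorem empType_apply [DecidableEq α] {n : ℕ} (x : Fin n → α) (a : α) :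
    empType x a = (∑ j, if x j = a then (1 : ℝ) else 0) / n := by
  simp only [empType, Finset.sum_boole]
  congr

theorem empType_nonneg {n : ℕ} (x : Fin n → α) (a : α) : 0 ≤ empType x a := by
  unfold empType; positivity

theorem sum_empType_mul [Fintype α] {n : ℕ} (x : Fin n → α) (g : α → ℝ) :
    ∑ a, empType x a * g a = (∑ j, g (x j)) / n := by
  classical
  simp only [empType_apply, div_mul_eq_mul_div, ← Finset.sum_div, Finset.sum_mul]
  rw [Finset.sum_comm]
  simp

theorem empType_mem_stdSimplex [Fintype α] {n : ℕ} (hn : 0 < n) (x : Fin n → α) :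
    empType x ∈ stdSimplex ℝ α := by
  refine ⟨empType_nonneg x, ?_⟩
  have := sum_empType_mul x fun _ => 1
  simp only [mul_one, Finset.sum_const, Finset.card_univ, Fintype.card_fin, nsmul_eq_mul] at this
  rw [this, div_self]
  exact_mod_cast hn.ne'

theorem sum_jointType_mul [Fintype α] {L n : ℕ} (v : Fin L → Fin n → α) (g : (Fin L → α) → ℝ) :
    ∑ a, jointType v a * g a = (∑ j, g fun i => v i j) / n :=
  sum_empType_mul _ g

end EmpiricalTypes

/-! ### Tensor powers and the cone of completely positive tensors. -/

section TensorPowers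

variable {α : Type*}

/-- The tensor power `p^{⊗L}`. -/
def tensorPow (L : ℕ) (p : α → ℝ) : (Fin L → α) → ℝ := fun a => ∏ i, p (a i)

theorem tensorPow_nonneg {L : ℕ} {p : α → ℝ} (hp : ∀ a, 0 ≤ p a) (a : Fin L → α) :
    0 ≤ tensorPow L p a := Finset.prod_nonneg fun _ _ => hp _

theorem marginal_tensorPow [Fintype α] {L : ℕ} {p : α → ℝ} (hp : ∑ a, p a = 1) (i : Fin L) :
    marginal (fun a => a i) (tensorPow L p) = p := by
  classical
  ext x
  have h := Finset.prod_univ_sum (fun k : Fin L => if k = i then {x} else (univ : Finset α))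
    (fun _ y => p y)
  have h1 : ∏ k : Fin L, ∑ y ∈ (if k = i then {x} else (univ : Finset α)), p y = p x := by
    rw [Finset.prod_eq_single i]
    · simp
    · intro k _ hk
      simp [hk, hp]
    · simp
  rw [h1] at h
  rw [h, marginal_apply, ← Finset.sum_filter]
  refine Finset.sum_congr ?_ fun a _ => rfl
  ext a
  simp only [Finset.mem_filter, Finset.mem_univ, true_and, Fintype.mem_piFinset]
  constructor
  · intro ha k
    split_ifs with hk
    · subst hk; simp [ha]
    · simp
  · intro ha
    simpa using ha i

theorem sum_tensorPow [Fintype α] {L : ℕ} {p : α → ℝ} (hp : ∑ a, p a = 1) :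
    ∑ a, tensorPow L p a = 1 := by
  classical
  have h := Finset.prod_univ_sum (fun _ : Fin L => (univ : Finset α)) (fun _ y => p y)
  simp only [hp, Finset.prod_const_one, Fintype.piFinset_univ] at h
  exact h.symm

theorem tensorPow_mem_stdSimplex [Fintype α] (L : ℕ) {p : α → ℝ} (hp : p ∈ stdSimplex ℝ α) :
    tensorPow L p ∈ stdSimplex ℝ (Fin L → α) :=
  ⟨tensorPow_nonneg hp.1, sum_tensorPow hp.2⟩

theorem tensorPow_mem_selfCouplings [Fintype α] (L : ℕ) {p : α → ℝ} (hp : p ∈ stdSimplex ℝ α) :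
    tensorPow L p ∈ selfCouplings L p :=
  ⟨tensorPow_mem_stdSimplex L hp, marginal_tensorPow hp.2⟩

theorem isCP_tensorPow {L : ℕ} {p : α → ℝ} (hp : ∀ a, 0 ≤ p a) : IsCP (tensorPow L p) :=
  ⟨1, le_rfl, fun _ => p, fun _ => hp, fun x => by simp [tensorPow]⟩

theorem IsCP.add {L : ℕ} {T U : (Fin L → α) → ℝ} (hT : IsCP T) (hU : IsCP U) : IsCP (T + U) := by
  obtain ⟨r, hr, p, hp, hT⟩ := hT
  obtain ⟨r', -, p', hp', hU⟩ := hU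
  refine ⟨r + r', by omega, Fin.append p p', fun j => ?_, fun x => ?_⟩
  · refine Fin.addCases (fun i => ?_) (fun i => ?_) j
    · simpa using hp i
    · simpa using hp' i
  · simp [Fin.sum_univ_add, hT, hU]

/-- The scalar is absorbed into each factor as its `L`-th root, which is why `L ≠ 0` is needed. -/
theorem IsCP.smul {L : ℕ} (hL : L ≠ 0) {T : (Fin L → α) → ℝ} (hT : IsCP T) {c : ℝ} (hc : 0 ≤ c) :
    IsCP (c • T) := by
  obtain ⟨r, hr, p, hp, hT⟩ := hT
  refine ⟨r, hr, fun j a => c ^ ((L : ℝ)⁻¹) * p j a, fun j a => ?_, fun x => ?_⟩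
  · have := hp j a
    positivity
  · have h : (c ^ ((L : ℝ)⁻¹)) ^ L = c := by
      rw [← Real.rpow_natCast, ← Real.rpow_mul hc, inv_mul_cancel₀ (by exact_mod_cast hL),
        Real.rpow_one]
    simp [Finset.prod_mul_distrib, h, hT, Finset.mul_sum]

theorem isCP_zero {L : ℕ} (hL : L ≠ 0) : IsCP (0 : (Fin L → α) → ℝ) :=
  ⟨1, le_rfl, fun _ _ => 0, fun _ _ => le_rfl, fun x => by simp [hL]⟩

theorem isCP_sum {L : ℕ} (hL : L ≠ 0) {ι : Type*} (s : Finset ι) {T : ι → (Fin L → α) → ℝ}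
    (hT : ∀ i ∈ s, IsCP (T i)) : IsCP (∑ i ∈ s, T i) := by
  classical
  induction s using Finset.induction_on with
  | empty => exact isCP_zero hL
  | insert i s hi ih =>
    rw [Finset.sum_insert hi]
    exact (hT i (by simp)).add (ih fun k hk => hT k (by simp [hk]))

end TensorPowers

/-! ### Nearly spreadable sequences of words are near mixtures of tensor powers. -/

section Spreadable

theorem abs_prod_sub_prod_le {ι : Type*} (s : Finset ι) {x y : ι → ℝ}
    (hx : ∀ i ∈ s, |x i| ≤ 1) (hy : ∀ i ∈ s, |y i| ≤ 1) :
    |∏ i ∈ s, x i - ∏ i ∈ s, y i| ≤ ∑ i ∈ s, |x i - y i| := by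
  classical
  induction s using Finset.induction_on with
  | empty => simp
  | insert k s hk ih =>
    rw [Finset.prod_insert hk, Finset.prod_insert hk, Finset.sum_insert hk]
    have h1 := ih (fun i hi => hx i (by simp [hi])) fun i hi => hy i (by simp [hi])
    have h2 : |∏ i ∈ s, x i| ≤ 1 := by
      rw [Finset.abs_prod]
      exact Finset.prod_le_one (fun _ _ => abs_nonneg _) fun i hi => hx i (by simp [hi])
    have h3 : x k * ∏ i ∈ s, x i - y k * ∏ i ∈ s, y i
        = (x k - y k) * ∏ i ∈ s, x i + y k * (∏ i ∈ s, x i - ∏ i ∈ s, y i) := by ring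
    rw [h3]
    refine (abs_add_le _ _).trans (add_le_add ?_ ?_)
    · rw [abs_mul]
      exact mul_le_of_le_one_right (abs_nonneg _) h2
    · rw [abs_mul]
      exact (mul_le_of_le_one_left (abs_nonneg _) (hy k (by simp))).trans h1

/-- Weights of sum zero annihilate the constant part `ρ` of the Gram matrix. The off-diagonal
remainder costs `ζ` and the diagonal one at most `1` per entry. -/
theorem sum_sq_le_of_nearly_constant_gram {ι κ : Type*} [Fintype ι] [Fintype κ]
    (u : ι → κ → ℝ) (w : ι → ℝ) (hw : ∑ s, w s = 0) {N ρ ζ : ℝ} (hζ : 0 ≤ ζ)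
    (hne : ∀ s t, s ≠ t → |(∑ j, u s j * u t j) / N - ρ| ≤ ζ)
    (heq : ∀ s, |(∑ j, u s j * u s j) / N - ρ| ≤ 1) :
    (∑ j, (∑ s, w s * u s j) ^ 2) / N ≤ ζ * (∑ s, |w s|) ^ 2 + ∑ s, w s ^ 2 := by
  classical
  have h1 : (∑ j, (∑ s, w s * u s j) ^ 2) / N
      = ∑ s, ∑ t, w s * w t * ((∑ j, u s j * u t j) / N) := by
    have : ∀ j, (∑ s, w s * u s j) ^ 2 = ∑ s, ∑ t, w s * w t * (u s j * u t j) := by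
      intro j
      rw [sq, Finset.sum_mul_sum]
      exact Finset.sum_congr rfl fun s _ => Finset.sum_congr rfl fun t _ => by ring
    simp only [this]
    rw [Finset.sum_comm, Finset.sum_div]
    refine Finset.sum_congr rfl fun s _ => ?_
    rw [Finset.sum_comm, Finset.sum_div]
    refine Finset.sum_congr rfl fun t _ => ?_
    rw [← Finset.mul_sum, mul_div_assoc]
  have h2 : ∑ s, ∑ t, w s * w t * ρ = 0 := by
    simp [← Finset.sum_mul, ← Finset.mul_sum, hw]
  have h3 : (∑ j, (∑ s, w s * u s j) ^ 2) / N
      = ∑ s, ∑ t, w s * w t * ((∑ j, u s j * u t j) / N - ρ) := by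
    simp only [mul_sub, Finset.sum_sub_distrib, h2, sub_zero, h1]
  have h4 : ∀ s t, w s * w t * ((∑ j, u s j * u t j) / N - ρ)
      ≤ ζ * (|w s| * |w t|) + if s = t then w s ^ 2 else 0 := by
    intro s t
    refine (le_abs_self _).trans ?_
    rw [abs_mul, abs_mul]
    split_ifs with h
    · subst h
      have := mul_le_mul_of_nonneg_left (heq s) (mul_nonneg (abs_nonneg (w s)) (abs_nonneg (w s)))
      have h0 : 0 ≤ ζ * (|w s| * |w s|) := by positivity
      rw [← sq_abs (w s)]
      linarith
    · have := mul_le_mul_of_nonneg_left (hne s t h)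
        (mul_nonneg (abs_nonneg (w s)) (abs_nonneg (w t)))
      linarith
  rw [h3]
  refine (Finset.sum_le_sum fun s _ => Finset.sum_le_sum fun t _ => h4 s t).trans (le_of_eq ?_)
  simp only [Finset.sum_add_distrib, Finset.sum_ite_eq, Finset.mem_univ, if_true]
  congr 1
  rw [sq, Finset.sum_mul_sum, Finset.mul_sum]
  exact Finset.sum_congr rfl fun s _ => by rw [Finset.mul_sum]

variable {X : Type*} {n : ℕ}

/-- The empirical law of the entries in position `j` of the words in the `i`-th block of `K`
consecutive words. -/
def blockLaw (c : ℕ → Fin n → X) (K i : ℕ) (j : Fin n) : X → ℝ :=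
  empType fun r : Fin K => c (i * K + r) j

theorem blockLaw_mem_stdSimplex [Fintype X] (c : ℕ → Fin n → X) {K : ℕ} (hK : 0 < K) (i : ℕ) (j : Fin n) :
    blockLaw c K i j ∈ stdSimplex ℝ X :=
  empType_mem_stdSimplex hK _

/-- A product of averages is the average over all choices of one word from each block; these choices
are increasing tuples. -/
theorem sum_prod_blockLaw {L K : ℕ} (c : ℕ → Fin n → X) (a : Fin L → X) :
    (∑ j, ∏ i : Fin L, blockLaw c K i j (a i)) / n
      = (∑ r : Fin L → Fin K, jointType (fun i => c (i * K + r i)) a) / K ^ L := by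
  classical
  have h1 : ∀ j : Fin n, ∏ i : Fin L, blockLaw c K i j (a i)
      = (∑ r : Fin L → Fin K, if (fun i : Fin L => c (i * K + r i) j) = a then (1 : ℝ) else 0)
        / K ^ L := by
    intro j
    simp only [blockLaw, empType_apply, Finset.prod_div_distrib, Finset.prod_const,
      Finset.card_univ, Fintype.card_fin]
    rw [Finset.prod_univ_sum, Fintype.piFinset_univ]
    congr 1
    refine Finset.sum_congr rfl fun r _ => ?_
    rw [Finset.prod_ite_zero]
    simp [funext_iff]
  simp only [h1, jointType, empType_apply, ← Finset.sum_div]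
  rw [Finset.sum_comm, div_right_comm]

variable [Fintype X]

theorem abs_sum_prod_blockLaw_sub_le {L K : ℕ} (hK : 0 < K) (c : ℕ → Fin n → X)
    {P : (Fin L → X) → ℝ} {ζ : ℝ}
    (h : ∀ t : Fin L → ℕ, StrictMono t → (∀ i, t i < L * K + L) →
      savNorm (fun x => jointType (fun i => c (t i)) x - P x) ≤ ζ) (a : Fin L → X) :
    |(∑ j, ∏ i : Fin L, blockLaw c K i j (a i)) / n - P a| ≤ ζ := by
  have hr : ∀ r : Fin L → Fin K, |jointType (fun i => c (i * K + r i)) a - P a| ≤ ζ := by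
    intro r
    refine (abs_le_savNorm (fun x => jointType (fun i => c (i * K + r i)) x - P x) a).trans
      (h (fun i => i * K + r i) ?_ ?_)
    · intro i k hik
      have h1 : (i : ℕ) + 1 ≤ k := hik
      have h2 := Nat.mul_le_mul_right K h1
      have h3 := (r i).2
      simp only
      rw [add_mul] at h2
      omega
    · intro i
      have h1 : (i : ℕ) + 1 ≤ L := i.2
      have h2 := Nat.mul_le_mul_right K h1
      have h3 := (r i).2
      rw [add_mul] at h2
      omega
  have hK' : (0 : ℝ) < K ^ L := by positivity
  rw [sum_prod_blockLaw, div_sub' hK'.ne', abs_div, abs_of_pos hK', div_le_iff₀ hK']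
  have h1 : (∑ r : Fin L → Fin K, jointType (fun i => c (i * K + r i)) a) - K ^ L * P a
      = ∑ r : Fin L → Fin K, (jointType (fun i => c (i * K + r i)) a - P a) := by
    simp
  rw [h1]
  refine (Finset.abs_sum_le_sum_abs _ _).trans ((Finset.sum_le_sum fun r _ => hr r).trans ?_)
  simp [mul_comm]

/-- The correlation of two words is read off from the first two coordinates of the joint type of any
increasing tuple that starts with them, so it is nearly independent of the pair. -/
theorem abs_pair_correlation_sub_le {L m : ℕ} (hL : 2 ≤ L) (c : ℕ → Fin n → X)
    {P : (Fin L → X) → ℝ} {ζ : ℝ}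
    (h : ∀ t : Fin L → ℕ, StrictMono t → (∀ i, t i < m + L) →
      savNorm (fun x => jointType (fun i => c (t i)) x - P x) ≤ ζ) [DecidableEq X] (x : X)
    {s t : ℕ} (hst : s ≠ t) (hs : s < m) (ht : t < m) :
    |(∑ j, (if c s j = x then (1 : ℝ) else 0) * (if c t j = x then 1 else 0)) / n
      - ∑ a : Fin L → X, P a * ((if a ⟨0, by omega⟩ = x then 1 else 0) *
        (if a ⟨1, by omega⟩ = x then 1 else 0))| ≤ ζ := by
  wlog hlt : s < t generalizing s t
  · have := this hst.symm ht hs (by omega)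
    simpa only [mul_comm (if c s _ = x then (1 : ℝ) else 0)] using this
  -- The remaining `L - 2` places are filled with indices beyond `m`; this is the purpose of the
  -- slack `L` in the bound `m + L`.
  let τ : Fin L → ℕ := fun i => if (i : ℕ) = 0 then s else if (i : ℕ) = 1 then t else m + i
  have hτ : StrictMono τ := by
    intro i k hik
    have : (i : ℕ) < k := hik
    simp only [τ]
    split_ifs <;> omega
  have hτ' : ∀ i, τ i < m + L := by
    intro i
    have := i.2
    simp only [τ]
    split_ifs <;> omega
  refine le_trans ?_ (h τ hτ hτ')
  have h1 := sum_jointType_mul (fun i => c (τ i)) fun a : Fin L → X =>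
    (if a ⟨0, by omega⟩ = x then (1 : ℝ) else 0) * (if a ⟨1, by omega⟩ = x then 1 else 0)
  have h2 : τ ⟨0, by omega⟩ = s := by simp [τ]
  have h3 : τ ⟨1, by omega⟩ = t := by simp [τ]
  simp only [h2, h3] at h1
  rw [← h1, ← Finset.sum_sub_distrib]
  simp only [← sub_mul]
  refine abs_sum_mul_le_savNorm (fun a => jointType (fun i => c (τ i)) a - P a) _ fun a => ?_
  split_ifs <;> simp

theorem sum_sq_blockLaw_sub_le {L K : ℕ} (hn : 0 < n) (hL : 2 ≤ L) (hK : 0 < K)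
    (c : ℕ → Fin n → X) {P : (Fin L → X) → ℝ} (hP : P ∈ stdSimplex ℝ (Fin L → X)) {ζ : ℝ}
    (hζ : 0 ≤ ζ)
    (h : ∀ t : Fin L → ℕ, StrictMono t → (∀ i, t i < L * K + L) →
      savNorm (fun x => jointType (fun i => c (t i)) x - P x) ≤ ζ) (i : Fin L) (x : X) :
    (∑ j, (blockLaw c K i j x - blockLaw c K 0 j x) ^ 2) / n ≤ 4 * ζ + 2 / K := by
  classical
  have hK0 : (0 : ℝ) < K := by exact_mod_cast hK
  have hn0 : (0 : ℝ) < n := by exact_mod_cast hn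
  -- The Gram estimate needs pairwise distinct words, so the comparison of block `0` with itself is
  -- separate.
  by_cases hi : (i : ℕ) = 0
  · simp only [hi, sub_self]
    simp
    positivity
  let e : Fin K ⊕ Fin K → ℕ := Sum.elim (fun r => i * K + r) fun r => r
  have hbase : K ≤ i * K := Nat.le_mul_of_pos_left K (by omega)
  have he : ∀ s t, s ≠ t → e s ≠ e t := by
    rintro (s | s) (t | t) hst <;> have := s.2 <;> have := t.2 <;>
      simp only [ne_eq, Sum.inl.injEq, Sum.inr.injEq, Fin.ext_iff] at hst <;>
      simp only [e, Sum.elim_inl, Sum.elim_inr] <;> omega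
  have hiL := Nat.mul_le_mul_right K (show (i : ℕ) + 1 ≤ L from i.2)
  rw [add_mul] at hiL
  have he' : ∀ s, e s < L * K := by
    rintro (s | s) <;> have := s.2 <;> simp only [e, Sum.elim_inl, Sum.elim_inr] <;> omega
  -- These weights have sum `0`, absolute sum `2` and square sum `2 / K`, whence the bound `4 * ζ +
  -- 2 / K`.
  let w : Fin K ⊕ Fin K → ℝ := Sum.elim (fun _ => 1 / K) fun _ => -(1 / K)
  have hρ0 : ∀ a : Fin L → X, 0 ≤ P a * ((if a ⟨0, by omega⟩ = x then (1 : ℝ) else 0) *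
      (if a ⟨1, by omega⟩ = x then 1 else 0)) ∧
      P a * ((if a ⟨0, by omega⟩ = x then (1 : ℝ) else 0) *
      (if a ⟨1, by omega⟩ = x then 1 else 0)) ≤ P a := by
    intro a
    have := hP.1 a
    split_ifs <;> simp [this]
  have hmain := sum_sq_le_of_nearly_constant_gram
    (fun s j => if c (e s) j = x then (1 : ℝ) else 0) w (by simp [w, Fintype.sum_sum_type])
    (N := n) (ρ := ∑ a : Fin L → X, P a * ((if a ⟨0, by omega⟩ = x then (1 : ℝ) else 0) *
        (if a ⟨1, by omega⟩ = x then 1 else 0))) hζ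
    (fun s t hst => abs_pair_correlation_sub_le hL c h x (he s t hst) (he' s) (he' t)) ?_
  · have h1 : ∀ j, ∑ s, w s * (if c (e s) j = x then (1 : ℝ) else 0)
        = blockLaw c K i j x - blockLaw c K 0 j x := by
      intro j
      simp only [Fintype.sum_sum_type, w, e, Sum.elim_inl, Sum.elim_inr, ← Finset.mul_sum,
        blockLaw, empType_apply, zero_mul, zero_add, mul_one, neg_mul, div_eq_inv_mul,
        Finset.sum_neg_distrib]
      rw [sub_eq_add_neg]
      congr!
    simp only [h1] at hmain
    refine hmain.trans (le_of_eq ?_)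
    simp only [Fintype.sum_sum_type, w, Sum.elim_inl, Sum.elim_inr, Finset.sum_const,
      Finset.card_univ, Fintype.card_fin, abs_neg, abs_of_pos (one_div_pos.2 hK0), nsmul_eq_mul]
    field_simp
    ring
  · intro s
    have h1 : 0 ≤ (∑ j, (if c (e s) j = x then (1 : ℝ) else 0) *
        (if c (e s) j = x then (1 : ℝ) else 0)) / n :=
      div_nonneg (Finset.sum_nonneg fun j _ => by split_ifs <;> simp) hn0.le
    have h2 : (∑ j, (if c (e s) j = x then (1 : ℝ) else 0) *
        (if c (e s) j = x then (1 : ℝ) else 0)) / n ≤ 1 := by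
      rw [div_le_one hn0]
      refine (Finset.sum_le_sum (g := fun _ => (1 : ℝ)) fun j _ => ?_).trans (by simp)
      split_ifs <;> simp
    have h3 := Finset.sum_nonneg fun a (_ : a ∈ univ) => (hρ0 a).1
    have h4 := Finset.sum_le_sum fun a (_ : a ∈ univ) => (hρ0 a).2
    rw [hP.2] at h4
    rw [abs_le]
    constructor <;> linarith

/-- The average over the positions of the tensor powers of the column laws of the first `K`
words. -/
def columnMixture (L K : ℕ) (c : ℕ → Fin n → X) : (Fin L → X) → ℝ :=
  ∑ j, (n : ℝ)⁻¹ • tensorPow L (blockLaw c K 0 j)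

/-- If all increasing tuples of a long sequence of words have nearly the same joint type, then
this joint type is nearly a mixture of tensor powers. -/
theorem abs_sub_columnMixture_le {L K : ℕ} (hn : 0 < n) (hL : 2 ≤ L) (hK : 0 < K)
    (c : ℕ → Fin n → X) {P : (Fin L → X) → ℝ} (hP : P ∈ stdSimplex ℝ (Fin L → X)) {ζ η : ℝ}
    (hη : 0 < η) (hζη : 4 * ζ + 2 / K ≤ η ^ 2)
    (h : ∀ t : Fin L → ℕ, StrictMono t → (∀ i, t i < L * K + L) →
      savNorm (fun x => jointType (fun i => c (t i)) x - P x) ≤ ζ) (a : Fin L → X) :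
    |P a - columnMixture L K c a| ≤ ζ + L * η := by
  have hn0 : (0 : ℝ) < n := by exact_mod_cast hn
  have hζ : 0 ≤ ζ := by
    refine le_trans ?_ (h (fun i => i) (fun i k hik => hik) fun i => by omega)
    exact Finset.sum_nonneg fun _ _ => abs_nonneg _
  have h1 := abs_sum_prod_blockLaw_sub_le hK c h a
  have hle : ∀ (i : ℕ) (j : Fin n) x, |blockLaw c K i j x| ≤ 1 := by
    intro i j x
    have hb := blockLaw_mem_stdSimplex c hK i j
    rw [abs_of_nonneg (hb.1 x), ← hb.2]
    exact Finset.single_le_sum (fun y _ => hb.1 y) (Finset.mem_univ x)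
  have h2 : ∀ (i : Fin L) x, ∑ j, |blockLaw c K i j x - blockLaw c K 0 j x| ≤ n * η := by
    intro i x
    have hs := sum_sq_blockLaw_sub_le hn hL hK c hP hζ h i x
    have h3 := (div_le_iff₀ hn0).1 (hs.trans hζη)
    -- The inequality of arithmetic and geometric means passes from the mean square bound `η ^ 2` to
    -- the mean absolute bound `η`.
    have h4 : ∀ j, |blockLaw c K i j x - blockLaw c K 0 j x|
        ≤ η / 2 + (blockLaw c K i j x - blockLaw c K 0 j x) ^ 2 / (2 * η) := by
      intro j
      rw [← sq_abs (blockLaw c K i j x - blockLaw c K 0 j x), div_add_div _ _ (by simp) (by positivity),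
        le_div_iff₀ (by positivity)]
      nlinarith [sq_nonneg (|blockLaw c K i j x - blockLaw c K 0 j x| - η)]
    refine (Finset.sum_le_sum fun j _ => h4 j).trans ?_
    rw [Finset.sum_add_distrib]
    have h5 : (∑ j, (blockLaw c K i j x - blockLaw c K 0 j x) ^ 2) / (2 * η) ≤ n * η / 2 := by
      rw [div_le_iff₀ (by positivity)]
      nlinarith
    simp only [Finset.sum_const, Finset.card_univ, Fintype.card_fin, nsmul_eq_mul, Finset.sum_div] at h5 ⊢
    linarith
  have h3 : columnMixture L K c a = (∑ j, ∏ i : Fin L, blockLaw c K 0 j (a i)) / n := by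
    simp [columnMixture, tensorPow, Finset.sum_apply, ← Finset.mul_sum, div_eq_inv_mul]
  have h4 : |(∑ j, ∏ i : Fin L, blockLaw c K i j (a i)) / n
      - (∑ j, ∏ i : Fin L, blockLaw c K 0 j (a i)) / n| ≤ L * η := by
    rw [← sub_div, abs_div, abs_of_pos hn0, div_le_iff₀ hn0, ← Finset.sum_sub_distrib]
    refine (Finset.abs_sum_le_sum_abs _ _).trans ?_
    refine (Finset.sum_le_sum fun j _ => abs_prod_sub_prod_le univ
      (fun (i : Fin L) _ => hle i j (a i)) (fun i _ => hle 0 j (a i))).trans ?_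
    rw [Finset.sum_comm]
    refine (Finset.sum_le_sum fun i _ => h2 i (a i)).trans (le_of_eq ?_)
    simp
    ring
  rw [h3]
  rw [abs_sub_comm] at h1
  exact (abs_sub_le _ _ _).trans (add_le_add h1 h4)

end Spreadable

/-! ### Compactness of the mixtures, and bounds for equicoupled codes. -/

section Compactness

/-- By Carathéodory's theorem `finrank + 1` points suffice, so the hull is a continuous image of a
simplex times a power of `s`. Shorter combinations are padded with zero weights at `z₀`. -/
theorem isCompact_convexHull_of_isCompact {E : Type*} [NormedAddCommGroup E] [NormedSpace ℝ E]
    [FiniteDimensional ℝ E] {s : Set E} (hs : IsCompact s) : IsCompact (convexHull ℝ s) := by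
  classical
  rcases s.eq_empty_or_nonempty with rfl | ⟨z₀, hz₀⟩
  · simp
  let d := Module.finrank ℝ E + 1
  have hc : IsCompact ((fun q : (Fin d → ℝ) × (Fin d → E) => ∑ i, q.1 i • q.2 i) ''
      (stdSimplex ℝ (Fin d) ×ˢ Set.univ.pi fun _ => s)) :=
    ((isCompact_stdSimplex ℝ (Fin d)).prod (isCompact_univ_pi fun _ => hs)).image (by fun_prop)
  convert hc
  refine Set.Subset.antisymm (fun x hx => ?_) ?_
  · obtain ⟨ι, _, z, w, hz, hind, hw, hw1, rfl⟩ := eq_pos_convex_span_of_mem_convexHull hx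
    have hcard : Fintype.card ι ≤ Fintype.card (Fin d) := by
      rw [Fintype.card_fin]
      exact hind.card_le_finrank_succ.trans (Nat.succ_le_succ (Submodule.finrank_le _))
    obtain ⟨f⟩ := Function.Embedding.nonempty_of_card_le hcard
    have hoff : ∀ k ∉ Set.range f, Function.extend f w 0 k = 0 := fun k hk =>
      Function.extend_apply' _ _ _ hk
    refine ⟨(Function.extend f w 0, Function.extend f z fun _ => z₀), ⟨⟨fun k => ?_, ?_⟩, ?_⟩, ?_⟩
    · by_cases hk : k ∈ Set.range f
      · obtain ⟨i, rfl⟩ := hk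
        simpa [f.injective.extend_apply] using (hw i).le
      · exact (hoff k hk).ge
    · rw [← hw1]
      exact (Fintype.sum_of_injective f f.injective _ _ hoff fun i => by
        simp [f.injective.extend_apply]).symm
    · intro k _
      by_cases hk : k ∈ Set.range f
      · obtain ⟨i, rfl⟩ := hk
        simpa [f.injective.extend_apply] using hz ⟨i, rfl⟩
      · simpa [Function.extend_apply' _ _ _ hk] using hz₀
    · exact (Fintype.sum_of_injective f f.injective _ _ (fun k hk => by simp [hoff k hk]) fun i => by
        simp [f.injective.extend_apply]).symm
  · rintro _ ⟨⟨w, z⟩, ⟨hw, hz⟩, rfl⟩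
    exact (convex_convexHull ℝ s).sum_mem (fun i _ => hw.1 i) hw.2
      fun i _ => subset_convexHull ℝ s (hz i trivial)

variable {X : Type*} [Fintype X]

/-- The mixtures of tensor powers of distributions. -/
def powerMixtures (X : Type*) [Fintype X] (L : ℕ) : Set ((Fin L → X) → ℝ) :=
  convexHull ℝ (tensorPow L '' stdSimplex ℝ X)

theorem isCompact_powerMixtures (L : ℕ) : IsCompact (powerMixtures X L) :=
  isCompact_convexHull_of_isCompact <| (isCompact_stdSimplex ℝ X).image <|
    continuous_pi fun _ => continuous_finsetProd _ fun _ _ => continuous_apply _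

theorem isCP_of_mem_powerMixtures {L : ℕ} (hL : L ≠ 0) {T : (Fin L → X) → ℝ}
    (hT : T ∈ powerMixtures X L) : IsCP T := by
  have hconv : Convex ℝ {T : (Fin L → X) → ℝ | IsCP T} := fun T hT U hU a b ha hb _ =>
    (IsCP.smul hL hT ha).add (IsCP.smul hL hU hb)
  refine convexHull_min ?_ hconv hT
  rintro _ ⟨p, hp, rfl⟩
  exact isCP_tensorPow hp.1

theorem columnMixture_mem_powerMixtures {n K : ℕ} (hn : 0 < n) (hK : 0 < K) (L : ℕ)
    (c : ℕ → Fin n → X) : columnMixture L K c ∈ powerMixtures X L := by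
  have hn0 : (n : ℝ) ≠ 0 := by exact_mod_cast hn.ne'
  refine (convex_convexHull ℝ _).sum_mem (fun _ _ => by positivity) (by simp [hn0]) fun j _ => ?_
  exact subset_convexHull ℝ _ ⟨_, blockLaw_mem_stdSimplex c hK 0 j, rfl⟩

theorem exists_approximation_parameters (L : ℕ) {δ : ℝ} (hδ : 0 < δ) :
    ∃ ζ η : ℝ, ∃ K : ℕ, 0 < ζ ∧ 0 < η ∧ 0 < K ∧ 4 * ζ + 2 / K ≤ η ^ 2 ∧ ζ + L * η < δ := by
  let η := δ / (2 * (L + 1))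
  have hη : 0 < η := by positivity
  have h1 : (L + 1) * η = δ / 2 := by simp only [η]; field_simp
  obtain ⟨K, hK⟩ := exists_nat_gt (4 / η ^ 2)
  have hK0 : (0 : ℝ) < K := lt_trans (by positivity) hK
  refine ⟨min (η ^ 2 / 8) η, η, K, by positivity, hη, by exact_mod_cast hK0, ?_, ?_⟩
  · have h2 : 2 / (K : ℝ) ≤ η ^ 2 / 2 := by
      rw [div_le_iff₀ hK0]
      rw [div_lt_iff₀ (by positivity)] at hK
      linarith
    have := min_le_left (η ^ 2 / 8) η
    linarith
  · have := min_le_right (η ^ 2 / 8) η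
    linarith

/-- Equicoupled codes whose coupling lies in a compact set without mixtures of tensor powers are
uniformly bounded. -/
theorem exists_card_bound_of_equicoupled {L : ℕ} (hL : 2 ≤ L) {D : Set ((Fin L → X) → ℝ)}
    (hD : IsCompact D) (hDs : D ⊆ stdSimplex ℝ (Fin L → X))
    (hdisj : Disjoint D (powerMixtures X L)) :
    ∃ ζ : ℝ, 0 < ζ ∧ ∃ N : ℕ, ∀ P ∈ D, ∀ (n : ℕ) (C : Finset (Fin n → X)),
      IsEquicoupled ζ P C → C.card ≤ N := by
  -- A code with more than `L * K + L` words would place `P` within `δ` of a mixture, against the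
  -- disjointness of the thickenings.
  obtain ⟨δ, hδ, hth⟩ := hdisj.exists_thickenings hD (isCompact_powerMixtures L).isClosed
  obtain ⟨ζ, η, K, hζ, hη, hK, hζη, hlt⟩ := exists_approximation_parameters L hδ
  refine ⟨ζ, hζ, L * K + L, fun P hP n C hC => ?_⟩
  by_contra! hcard
  have hn : 0 < n := by
    rcases Nat.eq_zero_or_pos n with rfl | h
    · have := Finset.card_le_univ C
      simp only [Fintype.card_pi, Finset.univ_eq_empty, Finset.prod_empty] at this
      omega
    · exact h
  obtain ⟨c, hc⟩ := hC
  -- The default word beyond the enumeration never enters the tuples considered, whose indices stay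
  -- below `C.card`.
  let c' : ℕ → Fin n → X := fun k =>
    if hk : k < C.card then (c ⟨k, hk⟩).1 else (c ⟨0, by omega⟩).1
  have happ := abs_sub_columnMixture_le hn hL hK c' (hDs hP) hη hζη fun t ht htl => by
    have h1 := hc (fun i => ⟨t i, (htl i).trans hcard⟩) fun i k hik => ht hik
    have h2 : (fun i => (c ⟨t i, (htl i).trans hcard⟩).1) = fun i => c' (t i) := by
      ext1 i
      simp [c', (htl i).trans hcard]
    simpa only [h2] using h1
  have hT := columnMixture_mem_powerMixtures hn hK L c'
  refine Set.disjoint_left.1 hth (Metric.self_subset_thickening hδ D hP) ?_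
  rw [Metric.mem_thickening_iff]
  refine ⟨_, hT, (dist_pi_lt_iff hδ).2 fun a => ?_⟩
  rw [Real.dist_eq]
  exact (happ a).trans_lt hlt

theorem continuous_savNorm_sub {α : Type*} [Fintype α] (Q : α → ℝ) :
    Continuous fun P : α → ℝ => savNorm fun x => Q x - P x := by
  unfold savNorm
  fun_prop

theorem isClosed_selfCouplings (L : ℕ) (Px : X → ℝ) : IsClosed (selfCouplings L Px) := by
  classical
  have h : ∀ i : Fin L, Continuous fun P : (Fin L → X) → ℝ => marginal (fun x => x i) P := by
    intro i
    refine continuous_pi fun b => ?_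
    simp only [marginal_apply]
    refine continuous_finsetSum _ fun a _ => ?_
    split_ifs <;> fun_prop
  simp only [selfCouplings, Set.ofPred_and, Set.ofPred_forall]
  exact (isClosed_stdSimplex ℝ (Fin L → X)).inter
    (isClosed_iInter fun i => isClosed_eq (h i) continuous_const)

theorem exists_card_bound_of_distance {L : ℕ} (hL : 2 ≤ L) (Px : X → ℝ) {ρ : ℝ} (hρ : 0 < ρ) :
    ∃ ζ : ℝ, 0 < ζ ∧ ∃ N : ℕ, ∀ P ∈ selfCouplings L Px,
      (∀ Q ∈ cpSelfCouplings L Px, ρ ≤ savNorm fun x => Q x - P x) →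
      ∀ (n : ℕ) (C : Finset (Fin n → X)), IsEquicoupled ζ P C → C.card ≤ N := by
  -- The complement of the confusability set need not be closed, so it is replaced by the closed set
  -- of self-couplings at distance at least `ρ` from the completely positive ones.
  let D : Set ((Fin L → X) → ℝ) := selfCouplings L Px ∩
    ⋂ Q ∈ cpSelfCouplings L Px, {P | ρ ≤ savNorm fun x => Q x - P x}
  have hDc : IsCompact D := by
    refine (isCompact_stdSimplex ℝ (Fin L → X)).of_isClosed_subset
      ((isClosed_selfCouplings L Px).inter (isClosed_biInter fun Q _ =>
        isClosed_le continuous_const (continuous_savNorm_sub Q))) fun P hP => hP.1.1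
  obtain ⟨ζ, hζ, N, h⟩ := exists_card_bound_of_equicoupled hL hDc (fun P hP => hP.1.1) <| by
    refine Set.disjoint_left.2 fun P hP hP' => ?_
    have := Set.mem_iInter₂.1 hP.2 P ⟨hP.1, isCP_of_mem_powerMixtures (by omega) hP'⟩
    simp only [Set.mem_ofPred_eq, savNorm, sub_self, abs_zero, Finset.sum_const_zero] at this
    linarith
  exact ⟨ζ, hζ, N, fun P hP hd => h P ⟨hP, Set.mem_iInter₂.2 hd⟩⟩

theorem exists_card_bound_of_not_isCP {L : ℕ} (hL : 2 ≤ L) {P : (Fin L → X) → ℝ}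
    (hP : P ∈ stdSimplex ℝ (Fin L → X)) (hcp : ¬ IsCP P) :
    ∃ ζ : ℝ, 0 < ζ ∧ ∃ N : ℕ, ∀ (n : ℕ) (C : Finset (Fin n → X)),
      IsEquicoupled ζ P C → C.card ≤ N := by
  obtain ⟨ζ, hζ, N, h⟩ := exists_card_bound_of_equicoupled hL (isCompact_singleton (x := P))
    (by simpa using hP) <| by
      rw [Set.disjoint_singleton_left]
      exact fun h => hcp (isCP_of_mem_powerMixtures (by omega) h)
  exact ⟨ζ, hζ, N, h P rfl⟩

end Compactness

/-! ### Ramsey's theorem. -/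

section Ramsey

/-- Ramsey's theorem for `k`-element subsets. -/
theorem exists_ramsey_bound (k : ℕ) (κ : Type*) [Finite κ] [Nonempty κ] (M : ℕ) :
    ∃ N : ℕ, ∀ (s : Finset ℕ) (χ : Finset ℕ → κ), N ≤ s.card →
      ∃ t ⊆ s, t.card = M ∧ ∃ c, ∀ u ⊆ t, u.card = k → χ u = c := by
  classical
  induction k generalizing M with
  | zero =>
    refine ⟨M, fun s χ hs => ?_⟩
    obtain ⟨t, hts, ht⟩ := Finset.exists_subset_card_eq hs
    refine ⟨t, hts, ht, χ ∅, fun u _ hu => ?_⟩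
    rw [Finset.card_eq_zero.1 hu]
  | succ k ih =>
    -- First a set on which the colour depends only on the least element: fix the minimum, make the
    -- induced colouring of `k`-sets constant on the rest, and repeat. The pigeonhole principle on
    -- the colours `g` then finishes.
    have key : ∀ m : ℕ, ∃ N : ℕ, ∀ (s : Finset ℕ) (χ : Finset ℕ → κ), N ≤ s.card →
        ∃ t ⊆ s, t.card = m ∧ ∃ g : ℕ → κ, ∀ a u, insert a u ⊆ t → u.card = k →
          (∀ b ∈ u, a < b) → χ (insert a u) = g a := by
      intro m
      induction m with
      | zero =>
        refine ⟨0, fun s χ _ => ⟨∅, by simp, rfl, fun _ => Classical.arbitrary κ, ?_⟩⟩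
        intro a u hau
        exact absurd (hau (Finset.mem_insert_self a u)) (Finset.notMem_empty a)
      | succ m ihm =>
        obtain ⟨N, hN⟩ := ihm
        obtain ⟨N', hN'⟩ := ih N
        refine ⟨N' + 1, fun s χ hs => ?_⟩
        have hne : s.Nonempty := Finset.card_pos.1 (by omega)
        have hmin := Finset.min'_mem s hne
        obtain ⟨t', ht's, ht', c, hc⟩ := hN' (s.erase (s.min' hne))
          (fun u => χ (insert (s.min' hne) u)) (by rw [Finset.card_erase_of_mem hmin]; omega)
        obtain ⟨t, htt', ht, g, hg⟩ := hN t' χ ht'.ge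
        have hts : t ⊆ s.erase (s.min' hne) := htt'.trans ht's
        have hlt : ∀ b ∈ t, s.min' hne < b := fun b hb => by
          have := Finset.mem_erase.1 (hts hb)
          exact lt_of_le_of_ne (Finset.min'_le s b this.2) (Ne.symm this.1)
        have hnot : s.min' hne ∉ t := fun h => lt_irrefl _ (hlt _ h)
        refine ⟨insert (s.min' hne) t, Finset.insert_subset hmin
          (hts.trans (Finset.erase_subset _ _)), by rw [Finset.card_insert_of_notMem hnot, ht],
          Function.update g (s.min' hne) c, fun a u hau hu hlt' => ?_⟩
        have haut : ∀ b ∈ u, b ∈ insert (s.min' hne) t := fun b hb =>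
          hau (Finset.mem_insert_of_mem hb)
        rcases Finset.mem_insert.1 (hau (Finset.mem_insert_self a u)) with rfl | ha
        · rw [Function.update_self]
          refine hc u (fun b hb => htt' ?_) hu
          exact (Finset.mem_insert.1 (haut b hb)).resolve_left (hlt' b hb).ne'
        · rw [Function.update_of_ne (hlt a ha).ne']
          refine hg a u (Finset.insert_subset ha fun b hb => ?_) hu hlt'
          exact (Finset.mem_insert.1 (haut b hb)).resolve_left
            ((hlt a ha).trans (hlt' b hb)).ne'
    have := Fintype.ofFinite κ
    obtain ⟨N, hN⟩ := key (Fintype.card κ * M)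
    refine ⟨N, fun s χ hs => ?_⟩
    obtain ⟨t, hts, ht, g, hg⟩ := hN s χ hs
    obtain ⟨c, -, hc⟩ := Finset.exists_le_card_fiber_of_mul_le_card_of_maps_to
      (s := t) (t := univ) (f := g) (n := M) (fun _ _ => Finset.mem_univ _) Finset.univ_nonempty
      (by rw [ht, Finset.card_univ])
    obtain ⟨t', ht', hcard⟩ := Finset.exists_subset_card_eq hc
    refine ⟨t', ht'.trans ((Finset.filter_subset _ _).trans hts), hcard, c, fun u hu hk => ?_⟩
    have hne : u.Nonempty := Finset.card_pos.1 (by omega)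
    have hmin := Finset.min'_mem u hne
    have h1 := hg (u.min' hne) (u.erase (u.min' hne)) (by
      rw [Finset.insert_erase hmin]
      exact hu.trans (ht'.trans (Finset.filter_subset _ _))) (by
      rw [Finset.card_erase_of_mem hmin]; omega) fun b hb => by
      have := Finset.mem_erase.1 hb
      exact lt_of_le_of_ne (Finset.min'_le u b this.2) (Ne.symm this.1)
    rw [Finset.insert_erase hmin] at h1
    rw [h1]
    exact (Finset.mem_filter.1 (ht' (hu hmin))).2

end Ramsey

/-! ### Rounding joint laws to words. -/

section Rounding

/-- A finite set can be coloured so that the colour classes have sizes close to prescribed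
proportions, using only colours with a positive proportion. -/
theorem exists_coloring_card_le {ι B : Type*} [Fintype B] [DecidableEq B] (J : Finset ι)
    {π : B → ℝ} (hπ : π ∈ stdSimplex ℝ B) :
    ∃ f : ι → B, (∀ j ∈ J, 0 < π (f j)) ∧
      ∀ b, ((J.filter fun j => f j = b).card : ℝ) ≤ J.card * π b + 1 := by
  classical
  induction J using Finset.induction_on with
  | empty =>
    have : Nonempty B := by
      by_contra h
      rw [not_nonempty_iff] at h
      simpa using hπ.2
    exact ⟨fun _ => Classical.arbitrary B, by simp, by simp⟩
  | insert k J hk ih =>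
    obtain ⟨f, hf, hcard⟩ := ih
    have hsum : ∑ b, ((J.filter fun j => f j = b).card : ℝ) < ∑ b, ((J.card : ℝ) + 1) * π b := by
      rw [← Finset.mul_sum, hπ.2, mul_one, ← Nat.cast_sum,
        ← Finset.card_eq_sum_card_fiberwise fun _ _ => Finset.mem_univ _]
      linarith
    -- The new element gets a colour that is strictly below its quota. Such a colour exists because
    -- the counts sum to `J.card` and the quotas to `J.card + 1`; its quota, hence its proportion,
    -- is positive.
    obtain ⟨b₀, -, hb₀⟩ := Finset.exists_lt_of_sum_lt hsum
    have hold : ∀ j ∈ J, Function.update f k b₀ j = f j := fun j hj =>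
      Function.update_of_ne (by rintro rfl; exact hk hj) _ _
    refine ⟨Function.update f k b₀, fun j hj => ?_, fun b => ?_⟩
    · rcases Finset.mem_insert.1 hj with rfl | hj
      · rw [Function.update_self]
        have : (0 : ℝ) ≤ ((J.filter fun j => f j = b₀).card : ℝ) := by positivity
        exact pos_of_mul_pos_right (this.trans_lt hb₀) (by positivity)
      · rw [hold j hj]
        exact hf j hj
    · have hcongr : J.filter (fun j => Function.update f k b₀ j = b)
          = J.filter fun j => f j = b :=
        Finset.filter_congr fun j hj => by rw [hold j hj]
      rw [Finset.filter_insert, hcongr, Finset.card_insert_of_notMem hk, Function.update_self]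
      split_ifs with hb
      · subst hb
        rw [Finset.card_insert_of_notMem fun h => hk (Finset.mem_filter.1 h).1]
        push_cast
        linarith
      · have := hcard b
        have h0 := hπ.1 b
        push_cast
        nlinarith

theorem exists_coloring_abs_card_sub_le {ι B : Type*} [Fintype B] [DecidableEq B] (J : Finset ι)
    {π : B → ℝ} (hπ : π ∈ stdSimplex ℝ B) :
    ∃ f : ι → B, (∀ j ∈ J, 0 < π (f j)) ∧
      ∀ b, |((J.filter fun j => f j = b).card : ℝ) - J.card * π b| ≤ Fintype.card B := by
  classical
  obtain ⟨f, hf, hcard⟩ := exists_coloring_card_le J hπ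
  refine ⟨f, hf, fun b => abs_le.2 ⟨?_, ?_⟩⟩
  · have h1 : ∑ b, ((J.filter fun j => f j = b).card : ℝ) = J.card := by
      rw [← Nat.cast_sum, ← Finset.card_eq_sum_card_fiberwise fun _ _ => Finset.mem_univ _]
    -- The slacks in the upper bounds are nonnegative with sum `Fintype.card B`, so each is at most
    -- that; this is the lower bound.
    have h2 : ∑ b, ((J.card : ℝ) * π b + 1 - (J.filter fun j => f j = b).card)
        = Fintype.card B := by
      rw [Finset.sum_sub_distrib, Finset.sum_add_distrib, ← Finset.mul_sum, hπ.2, h1]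
      simp
    have h3 := Finset.single_le_sum (f := fun b => (J.card : ℝ) * π b + 1 -
      (J.filter fun j => f j = b).card) (fun b _ => sub_nonneg.2 (hcard b)) (Finset.mem_univ b)
    rw [h2] at h3
    linarith
  · have h1 : (1 : ℝ) ≤ Fintype.card B := by
      exact_mod_cast Fintype.card_pos_iff.2 ⟨b⟩
    linarith [hcard b]

/-- A word can be extended to a word of pairs whose type is close to a given joint law, as far as
the law of the first component permits it, without using forbidden pairs. -/
theorem exists_word_extension {A B : Type*} [Fintype A] [Fintype B] {n : ℕ} (hn : 0 < n)
    (x : Fin n → A) {E : A → B → ℝ} (hE : ∀ a b, 0 ≤ E a b) {ok : A → B → Prop}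
    (hok : ∀ a b, E a b ≠ 0 → ok a b) (hx : ∀ j, ∃ b, ok (x j) b) :
    ∃ s : Fin n → B, (∀ j, ok (x j) (s j)) ∧ ∀ g : B → ℝ, (∀ b, |g b| ≤ 1) →
      |(∑ j, g (s j)) / n - ∑ a, ∑ b, E a b * g b|
        ≤ (∑ a, |empType x a - ∑ b, E a b|)
          + Fintype.card A * (Fintype.card B : ℝ) ^ 2 / n := by
  classical
  have hn0 : (0 : ℝ) < n := by exact_mod_cast hn
  have hcard : ∀ a, ((univ.filter fun j => x j = a).card : ℝ) = n * empType x a := by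
    intro a
    rw [empType_apply, mul_div_cancel₀ _ hn0.ne']
    simp
  have key : ∀ a, ∃ f : Fin n → B, (∀ j, x j = a → ok a (f j)) ∧ ∀ g : B → ℝ, (∀ b, |g b| ≤ 1) →
      |(∑ j with x j = a, g (f j)) / n - ∑ b, E a b * g b|
        ≤ |empType x a - ∑ b, E a b| + (Fintype.card B : ℝ) ^ 2 / n := by
    intro a
    by_cases ha : ∃ j, x j = a
    · have hπ : ∃ π ∈ stdSimplex ℝ B, (∀ b, 0 < π b → ok a b) ∧
          ∀ b, E a b = π b * ∑ b, E a b := by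
        by_cases h0 : ∑ b, E a b = 0
        · have h0' := (Finset.sum_eq_zero_iff_of_nonneg fun b _ => hE a b).1 h0
          obtain ⟨j, rfl⟩ := ha
          obtain ⟨b₀, hb₀⟩ := hx j
          refine ⟨Pi.single b₀ 1, single_mem_stdSimplex ℝ b₀, fun b hb => ?_, fun b => ?_⟩
          · by_cases h : b = b₀
            · rwa [h]
            · simp [h] at hb
          · rw [h0, mul_zero]
            exact h0' b (Finset.mem_univ b)
        · refine ⟨fun b => E a b / ∑ b, E a b, ⟨fun b => ?_, ?_⟩, fun b hb => ?_, fun b => ?_⟩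
          · exact div_nonneg (hE a b) (Finset.sum_nonneg fun b _ => hE a b)
          · rw [← Finset.sum_div, div_self h0]
          · refine hok a b fun h => ?_
            simp [h] at hb
          · rw [div_mul_cancel₀ _ h0]
      obtain ⟨π, hπ, hπok, hπE⟩ := hπ
      obtain ⟨f, hf, hfc⟩ := exists_coloring_abs_card_sub_le (univ.filter fun j => x j = a) hπ
      refine ⟨f, fun j hj => hπok _ (hf j (by simp [hj])), fun g hg => ?_⟩
      have h1 : ∑ j with x j = a, g (f j)
          = ∑ b, (((univ.filter fun j => x j = a).filter fun j => f j = b).card : ℝ) * g b := by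
        rw [← Finset.sum_fiberwise_of_maps_to (t := univ) (g := f) fun _ _ => Finset.mem_univ _]
        refine Finset.sum_congr rfl fun b _ => ?_
        rw [Finset.sum_congr rfl fun j hj => by rw [(Finset.mem_filter.1 hj).2], Finset.sum_const,
          nsmul_eq_mul]
      have h2 : (∑ j with x j = a, g (f j)) / n - ∑ b, E a b * g b
          = (∑ b, ((((univ.filter fun j => x j = a).filter fun j => f j = b).card : ℝ)
              - n * empType x a * π b) * g b) / n
            + ∑ b, (empType x a - ∑ b, E a b) * π b * g b := by
        rw [h1, Finset.sum_div, Finset.sum_div, ← Finset.sum_sub_distrib, ← Finset.sum_add_distrib]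
        refine Finset.sum_congr rfl fun b _ => ?_
        rw [hπE b]
        field_simp
        ring
      rw [h2, add_comm |empType x a - ∑ b, E a b|]
      refine (abs_add_le _ _).trans (add_le_add ?_ ?_)
      · rw [abs_div, abs_of_pos hn0]
        refine div_le_div_of_nonneg_right ?_ hn0.le
        refine (Finset.abs_sum_le_sum_abs _ _).trans
          ((Finset.sum_le_sum (g := fun _ => (Fintype.card B : ℝ)) fun b _ => ?_).trans ?_)
        · rw [abs_mul, ← hcard a]
          exact (mul_le_of_le_one_right (abs_nonneg _) (hg b)).trans (hfc b)
        · simp [sq]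
      · refine (Finset.abs_sum_le_sum_abs _ _).trans ((Finset.sum_le_sum
          (g := fun b => |empType x a - ∑ b, E a b| * π b) fun b _ => ?_).trans ?_)
        · rw [abs_mul, abs_mul, abs_of_nonneg (hπ.1 b)]
          exact mul_le_of_le_one_right (mul_nonneg (abs_nonneg _) (hπ.1 b)) (hg b)
        · rw [← Finset.mul_sum, hπ.2, mul_one]
    · push Not at ha
      have : Nonempty B := ⟨(hx ⟨0, hn⟩).choose⟩
      refine ⟨fun _ => Classical.arbitrary B, fun j hj => absurd hj (ha j), fun g hg => ?_⟩
      have h1 : empType x a = 0 := by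
        rw [empType_apply]
        simp [ha]
      have h2 : (univ.filter fun j => x j = a) = ∅ := by simp [ha]
      rw [h1, h2, Finset.sum_empty, zero_div, zero_sub, zero_sub, abs_neg, abs_neg]
      have h3 : |∑ b, E a b * g b| ≤ |∑ b, E a b| := by
        rw [abs_of_nonneg (Finset.sum_nonneg fun b _ => hE a b)]
        refine (Finset.abs_sum_le_sum_abs _ _).trans (Finset.sum_le_sum fun b _ => ?_)
        rw [abs_mul, abs_of_nonneg (hE a b)]
        exact mul_le_of_le_one_right (hE a b) (hg b)
      have h4 : (0 : ℝ) ≤ (Fintype.card B : ℝ) ^ 2 / n := by positivity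
      linarith
  choose f hf hfg using key
  refine ⟨fun j => f (x j) j, fun j => hf _ j rfl, fun g hg => ?_⟩
  have h1 : ∑ j, g (f (x j) j) = ∑ a, ∑ j with x j = a, g (f a j) := by
    rw [← Finset.sum_fiberwise_of_maps_to (t := univ) (g := x) fun _ _ => Finset.mem_univ _]
    refine Finset.sum_congr rfl fun a _ => Finset.sum_congr rfl fun j hj => ?_
    rw [(Finset.mem_filter.1 hj).2]
  rw [h1, Finset.sum_div, ← Finset.sum_sub_distrib]
  refine (Finset.abs_sum_le_sum_abs _ _).trans
    ((Finset.sum_le_sum fun a _ => hfg a g hg).trans (le_of_eq ?_))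
  rw [Finset.sum_add_distrib]
  simp [mul_div_assoc]

end Rounding

/-! ### From confusable laws to confusable words. -/

section Confusability

/-- The homothety with centre `r` and ratio `1 / α` takes `p` to a point `u` within `ε` of `q`, so
`p` is a convex combination of two members of `Q`. The bound `ε ≤ q a` on the support keeps `u`
nonnegative. -/
theorem mem_of_near_segment {S : Type*} [Fintype S] {Q : Set (S → ℝ)} (hQ : Q ⊆ stdSimplex ℝ S)
    (hconv : Convex ℝ Q) {q : S → ℝ} (hmax : ∀ p ∈ Q, ∀ a, q a = 0 → p a = 0) {ε : ℝ}
    (hball : ∀ p ∈ stdSimplex ℝ S, (∀ a, q a = 0 → p a = 0) → (∀ a, |p a - q a| ≤ ε) → p ∈ Q)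
    (hεq : ∀ a, q a ≠ 0 → ε ≤ q a) {α : ℝ} (hα : 0 < α) (hα1 : α ≤ 1) {r : S → ℝ} (hr : r ∈ Q)
    {p : S → ℝ} (hp : p ∈ stdSimplex ℝ S) (hsupp : ∀ a, q a = 0 → p a = 0)
    (hnear : ∀ a, |p a - (α * q a + (1 - α) * r a)| ≤ α * ε) : p ∈ Q := by
  let u : S → ℝ := fun a => (p a - (1 - α) * r a) / α
  have hu0 : ∀ a, q a = 0 → u a = 0 := fun a ha => by
    simp [u, hsupp a ha, hmax r hr a ha]
  have hun : ∀ a, |u a - q a| ≤ ε := by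
    intro a
    have h1 : u a - q a = (p a - (α * q a + (1 - α) * r a)) / α := by
      simp only [u]
      field_simp
      ring
    rw [h1, abs_div, abs_of_pos hα, div_le_iff₀ hα, mul_comm ε]
    exact hnear a
  have hu : u ∈ Q := by
    refine hball u ⟨fun a => ?_, ?_⟩ hu0 hun
    · by_cases ha : q a = 0
      · exact (hu0 a ha).ge
      · have h1 := (abs_le.1 (hun a)).1
        have h2 := hεq a ha
        linarith
    · simp only [u]
      rw [← Finset.sum_div, Finset.sum_sub_distrib, ← Finset.mul_sum, hp.2, (hQ hr).2]
      field_simp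
      ring
  have h2 := hconv hu hr hα.le (sub_nonneg.2 hα1) (by ring)
  convert h2 using 1
  ext a
  simp only [u, Pi.add_apply, Pi.smul_apply, smul_eq_mul]
  field_simp
  ring

variable {X S Y : Type*} [Fintype X] [Fintype S]

/-- The input tuple `a` and the noise tuple `s` lead to one common output letter. -/
def Channel.Agree (A : Channel X S Y) {L : ℕ} (a : Fin L → X) (s : Fin L → S) : Prop :=
  ∃ y, ∀ i, A.W (a i) (s i) = y

/-- A confusable law has a joint law with noise tuples that agree and have admissible laws. -/
theorem Channel.ConfusableDistr.exists_coupling [Fintype Y] {A : Channel X S Y} {L : ℕ}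
    {P : (Fin L → X) → ℝ} (h : A.ConfusableDistr P) :
    ∃ E : (Fin L → X) → (Fin L → S) → ℝ, (∀ a s, 0 ≤ E a s) ∧ (∀ a, ∑ s, E a s = P a) ∧
      (∀ a s, E a s ≠ 0 → A.Agree a s) ∧
      ∃ r : Fin L → S → ℝ, (∀ i, r i ∈ A.noise) ∧
        (∀ i (g : S → ℝ), ∑ a, ∑ s, E a s * g (s i) = ∑ b, r i b * g b) ∧
        ∀ a s, E a s ≠ 0 → ∀ i, r i (s i) ≠ 0 := by
  classical
  obtain ⟨E, hE, hP, hnoise, hW⟩ := h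
  have hpos : ∀ a s, (∑ y, E (a, s, y)) ≠ 0 → ∃ y, 0 < E (a, s, y) := by
    intro a s has
    obtain ⟨y, -, hy⟩ := Finset.exists_ne_zero_of_sum_ne_zero has
    exact ⟨y, lt_of_le_of_ne (hE.1 _) hy.symm⟩
  refine ⟨fun a s => ∑ y, E (a, s, y), fun a s => Finset.sum_nonneg fun y _ => hE.1 _, fun a => ?_,
    fun a s has => ?_, fun i => marginal (fun e => e.2.1 i) E, hnoise, fun i g => ?_,
    fun a s has i => ?_⟩
  · rw [← hP, marginal_apply, Fintype.sum_prod_type, Finset.sum_eq_single a]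
    · simp [Fintype.sum_prod_type]
    · intro b _ hb
      simp [hb]
    · simp
  · obtain ⟨y, hy⟩ := hpos a s has
    refine ⟨y, fun i => ?_⟩
    by_contra hne
    have h1 := hW i (a i) (s i) y
    have h2 := le_marginal (fun e : (Fin L → X) × (Fin L → S) × Y => (e.1 i, e.2.1 i, e.2.2))
      hE.1 (a, s, y)
    dsimp only at h2
    rw [h1] at h2
    simp only [Channel.law, hne, if_false, mul_zero] at h2
    linarith
  · rw [sum_mul_marginal]
    simp [Fintype.sum_prod_type, Finset.sum_mul]
  · obtain ⟨y, hy⟩ := hpos a s has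
    exact (hy.trans_le (le_marginal (fun e : (Fin L → X) × (Fin L → S) × Y => e.2.1 i)
      hE.1 (a, s, y))).ne'

/-- The law of `(x, …, x)` for `x` of law `p`. -/
def diagLaw (L : ℕ) (p : X → ℝ) : (Fin L → X) → ℝ := marginal (fun x _ => x) p

theorem diagLaw_nonneg (L : ℕ) {p : X → ℝ} (hp : ∀ x, 0 ≤ p x) (a : Fin L → X) :
    0 ≤ diagLaw L p a := marginal_nonneg _ hp a

theorem sum_diagLaw_mul (L : ℕ) (p : X → ℝ) (g : (Fin L → X) → ℝ) :
    ∑ a, diagLaw L p a * g a = ∑ x, p x * g fun _ => x := sum_mul_marginal _ _ _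

theorem sum_diagLaw (L : ℕ) (p : X → ℝ) : ∑ a, diagLaw L p a = ∑ x, p x := sum_marginal _ _

theorem exists_of_diagLaw_ne_zero {L : ℕ} {p : X → ℝ} {a : Fin L → X} (h : diagLaw L p a ≠ 0) :
    ∃ x, a = (fun _ => x) ∧ p x ≠ 0 := by
  classical
  rw [diagLaw, marginal_apply] at h
  obtain ⟨x, -, hx⟩ := Finset.exists_ne_zero_of_sum_ne_zero h
  split_ifs at hx with hxa
  · exact ⟨x, hxa.symm, hx⟩
  · exact absurd rfl hx

/-- Words are confusable if their joint type is close to a mixture of a diagonal law and a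
confusable law: the diagonal part leaves room for noise in the interior of the constraint set. -/
theorem confusableWords_of_near [Fintype Y] (A : Channel X S Y) {L : ℕ} {q : S → ℝ}
    (hq : q ∈ A.noise) (hmax : ∀ p ∈ A.noise, ∀ a, q a = 0 → p a = 0) {ε : ℝ}
    (hball : ∀ p ∈ stdSimplex ℝ S, (∀ a, q a = 0 → p a = 0) → (∀ a, |p a - q a| ≤ ε) →
      p ∈ A.noise)
    (hεq : ∀ a, q a ≠ 0 → ε ≤ q a) {α : ℝ} (hα : 0 < α) (hα1 : α ≤ 1) {Px : X → ℝ}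
    (hPx : Px ∈ stdSimplex ℝ X) (hprod : A.ConfusableDistr (tensorPow L Px))
    {T : (Fin L → X) → ℝ} (hT : A.ConfusableDistr T) {n : ℕ} (hn : 0 < n)
    (v : Fin L → Fin n → X) (hv : ∀ i, empType (v i) = Px)
    (hnear : savNorm (fun a => jointType v a - (α * diagLaw L Px a + (1 - α) * T a))
      + Fintype.card (Fin L → X) * (Fintype.card (Fin L → S) : ℝ) ^ 2 / n ≤ α * ε) :
    A.ConfusableWords v := by
  classical
  obtain ⟨E₀, hE₀, hE₀P, hE₀a, r₀, hr₀, -, hr₀E⟩ := hprod.exists_coupling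
  obtain ⟨E, hE, hEP, hEa, r, hr, hrE, hrE'⟩ := hT.exists_coupling
  -- With probability `α` all inputs coincide and all noise letters coincide, independently, so the
  -- outputs agree. The `i`-th noise law is therefore `α q + (1 - α) r i`.
  let G : (Fin L → X) → (Fin L → S) → ℝ := fun a s =>
    α * (diagLaw L Px a * diagLaw L q s) + (1 - α) * E a s
  have hqs := A.noise_subset hq
  have hG : ∀ a s, 0 ≤ G a s := fun a s => add_nonneg
    (mul_nonneg hα.le (mul_nonneg (diagLaw_nonneg L hPx.1 a) (diagLaw_nonneg L hqs.1 s)))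
    (mul_nonneg (sub_nonneg.2 hα1) (hE a s))
  have hGsum : ∀ a, ∑ s, G a s = α * diagLaw L Px a + (1 - α) * T a := by
    intro a
    simp only [G]
    rw [Finset.sum_add_distrib, ← Finset.mul_sum, ← Finset.mul_sum, ← Finset.mul_sum,
      sum_diagLaw, hqs.2, hEP, mul_one]
  have hGnoise : ∀ (i : Fin L) (g : S → ℝ), ∑ a, ∑ s, G a s * g (s i)
      = α * ∑ b, q b * g b + (1 - α) * ∑ b, r i b * g b := by
    intro i g
    simp only [G, add_mul, mul_assoc, Finset.sum_add_distrib, ← Finset.mul_sum]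
    rw [hrE i g, ← Finset.sum_mul, sum_diagLaw, hPx.2, one_mul,
      sum_diagLaw_mul L q fun s => g (s i)]
  have hGok : ∀ a s, G a s ≠ 0 → A.Agree a s ∧ ∀ i, q (s i) ≠ 0 := by
    intro a s has
    by_cases h0 : E a s = 0
    · have h1 : diagLaw L Px a * diagLaw L q s ≠ 0 := fun h => has (by simp [G, h, h0])
      obtain ⟨x, rfl, -⟩ := exists_of_diagLaw_ne_zero (left_ne_zero_of_mul h1)
      obtain ⟨b, rfl, hb⟩ := exists_of_diagLaw_ne_zero (right_ne_zero_of_mul h1)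
      exact ⟨⟨A.W x b, fun _ => rfl⟩, fun _ => hb⟩
    · exact ⟨hEa a s h0, fun i hi => hrE' a s h0 i (hmax _ (hr i) _ hi)⟩
  -- Columns of `v` that `G` does not charge still need agreeing noise. It comes from the coupling
  -- of the product law, which charges every tuple of letters that occur.
  have hdef : ∀ j, ∃ s, A.Agree (fun i => v i j) s ∧ ∀ i, q (s i) ≠ 0 := by
    intro j
    have h1 : tensorPow L Px (fun i => v i j) ≠ 0 := by
      refine Finset.prod_ne_zero_iff.2 fun i _ => ?_
      have hn0 : (0 : ℝ) < n := by exact_mod_cast hn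
      rw [← hv i, empType_apply]
      refine (div_pos (Finset.sum_pos' (fun k _ => by split_ifs <;> simp)
        ⟨j, Finset.mem_univ j, by simp⟩) hn0).ne'
    rw [← hE₀P] at h1
    obtain ⟨s, -, hs⟩ := Finset.exists_ne_zero_of_sum_ne_zero h1
    exact ⟨s, hE₀a _ s hs, fun i hi => hr₀E _ s hs i (hmax _ (hr₀ i) _ hi)⟩
  obtain ⟨s, hs, hsg⟩ := exists_word_extension hn (fun j i => v i j) hG hGok hdef
  choose y hy using fun j => (hs j).1
  refine ⟨y, fun i j => s j i, fun i => ⟨?_, fun j => hy j i⟩⟩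
  refine mem_of_near_segment A.noise_subset A.noise_convex hmax hball hεq hα hα1 (hr i)
    (empType_mem_stdSimplex hn _) (fun b hb => ?_) fun b => ?_
  · rw [empType_apply, Finset.sum_eq_zero, zero_div]
    intro j _
    rw [if_neg]
    rintro rfl
    exact (hs j).2 i hb
  · have h1 := hsg (fun s => if s i = b then 1 else 0) fun s => by split_ifs <;> simp
    rw [hGnoise i fun b' => if b' = b then 1 else 0] at h1
    simp only [mul_ite, mul_one, mul_zero, Finset.sum_ite_eq', Finset.mem_univ, if_true,
      hGsum] at h1
    rw [empType_apply]
    exact h1.trans hnear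

end Confusability

/-! ### Common restrictions and their number. -/

section Restrictions

variable {X : Type*} [Fintype X]

theorem exists_restriction [DecidableEq X] {n m : ℕ} (hm : 0 < m) (x : Fin n → X) :
    ∃ f : Fin n → Option X, (∀ j b, f j = some b → x j = b) ∧
      (∀ b, (univ.filter fun j => x j = b).card ≤ m * (univ.filter fun j => f j = some b).card) ∧
      (univ.filter fun j => f j ≠ none).card ≤ n / m + Fintype.card X := by
  -- Of each letter the fraction `1 / m` of its occurrences is kept, rounded up; the rounding costs
  -- at most one position per letter.
  have h : ∀ b, ∃ J ⊆ univ.filter fun j => x j = b,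
      J.card = ((univ.filter fun j => x j = b).card + (m - 1)) / m := fun b => by
    refine Finset.exists_subset_card_eq ?_
    generalize (univ.filter fun j => x j = b).card = k
    rcases Nat.eq_zero_or_pos k with rfl | hk
    · rw [Nat.zero_add, Nat.div_eq_of_lt (by omega)]
    · refine Nat.div_le_of_le_mul ?_
      obtain ⟨k, rfl⟩ := Nat.exists_eq_succ_of_ne_zero hk.ne'
      obtain ⟨m, rfl⟩ := Nat.exists_eq_succ_of_ne_zero hm.ne'
      simp only [Nat.succ_eq_add_one, Nat.add_sub_cancel]
      nlinarith [Nat.zero_le (k * m)]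
  choose J hJ hcard using h
  have hfib : ∀ b, (univ.filter fun j => (if j ∈ J (x j) then some (x j) else none) = some b)
      = J b := by
    intro b
    ext j
    simp only [Finset.mem_filter, Finset.mem_univ, true_and]
    constructor
    · intro hj
      split_ifs at hj with hmem
      rw [Option.some.injEq] at hj
      rwa [← hj]
    · intro hj
      have := (Finset.mem_filter.1 (hJ b hj)).2
      rw [this, if_pos hj]
  refine ⟨fun j => if j ∈ J (x j) then some (x j) else none, fun j b hj => ?_, fun b => ?_, ?_⟩
  · dsimp only at hj
    split_ifs at hj
    exact Option.some.inj hj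
  · rw [hfib, hcard]
    generalize (univ.filter fun j => x j = b).card = k
    have h1 := Nat.div_add_mod (k + (m - 1)) m
    have h2 := Nat.mod_lt (k + (m - 1)) hm
    omega
  · have h1 : (univ.filter fun j => (if j ∈ J (x j) then some (x j) else none) ≠ none)
        ⊆ univ.biUnion J := by
      intro j hj
      simp only [Finset.mem_filter, Finset.mem_univ, true_and] at hj
      refine Finset.mem_biUnion.2 ⟨x j, Finset.mem_univ _, ?_⟩
      by_contra hmem
      exact hj (if_neg hmem)
    refine (Finset.card_le_card h1).trans (Finset.card_biUnion_le.trans ?_)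
    have h2 : ∑ b, (univ.filter fun j => x j = b).card = n := by
      rw [← Finset.card_eq_sum_card_fiberwise fun _ _ => Finset.mem_univ _]
      simp
    have h3 : m * ∑ b, (J b).card ≤ n + m * Fintype.card X := by
      rw [Finset.mul_sum]
      calc ∑ b, m * (J b).card ≤ ∑ b, ((univ.filter fun j => x j = b).card + m) := by
            refine Finset.sum_le_sum fun b _ => ?_
            rw [hcard]
            have := Nat.mul_div_le ((univ.filter fun j => x j = b).card + (m - 1)) m
            omega
        _ = n + m * Fintype.card X := by
            rw [Finset.sum_add_distrib, h2]
            simp [mul_comm]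
    have h4 : ∑ b, (J b).card ≤ (n + m * Fintype.card X) / m :=
      (Nat.le_div_iff_mul_le hm).2 (by rwa [mul_comm])
    rwa [Nat.add_mul_div_left _ _ hm] at h4

/-- A Chernoff bound: weighting each `f` by `u` to the power minus the size of its domain gives
total weight `(1 + card X / u) ^ n`, and each `f` counted has weight at least `u ^ (-k)`. -/
theorem card_partial_functions_le (n k : ℕ) {u : ℝ} (hu : 1 ≤ u) :
    ((univ.filter fun f : Fin n → Option X => (univ.filter fun j => f j ≠ none).card ≤ k).card : ℝ)
      ≤ u ^ k * (1 + Fintype.card X / u) ^ n := by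
  have hu0 : 0 < u := by linarith
  have h1 : (1 + Fintype.card X / u) ^ n
      = ∑ f : Fin n → Option X, (u ^ (univ.filter fun j => f j ≠ none).card)⁻¹ := by
    have h := Finset.prod_univ_sum (fun _ : Fin n => (univ : Finset (Option X)))
      fun _ o => if o ≠ none then u⁻¹ else 1
    simp only [Fintype.piFinset_univ, Fintype.sum_option, ne_eq, not_true_eq_false, if_false,
      reduceCtorEq, not_false_eq_true, if_true, Finset.sum_const, Finset.card_univ, nsmul_eq_mul,
      Finset.prod_const, Fintype.card_fin] at h
    rw [div_eq_mul_inv, h]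
    refine Finset.sum_congr rfl fun f _ => ?_
    rw [← Finset.prod_filter, Finset.prod_const, inv_pow]
  rw [h1, Finset.mul_sum, Finset.card_eq_sum_ones, Nat.cast_sum]
  refine (Finset.sum_le_sum fun f hf => ?_).trans (Finset.sum_le_sum_of_subset_of_nonneg
    (Finset.filter_subset _ _) fun f _ _ => by positivity)
  rw [← div_eq_mul_inv, Nat.cast_one, one_le_div (by positivity)]
  exact pow_le_pow_right₀ hu (Finset.mem_filter.1 hf).2

/-- A large code has a large subcode of constant type whose words have a common restriction that
contains at least a fraction `1 / m` of the occurrences of each letter. -/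
theorem exists_constant_type_subcode [DecidableEq X] {n m N : ℕ} (hm : 0 < m) (C : Finset (Fin n → X))
    (hC : (n + 1) ^ Fintype.card X * ((univ.filter fun f : Fin n → Option X =>
      (univ.filter fun j => f j ≠ none).card ≤ n / m + Fintype.card X).card) * N ≤ C.card) :
    ∃ C' ⊆ C, N ≤ C'.card ∧ ∃ f : Fin n → Option X, ∃ p : X → ℝ,
      ∀ x ∈ C', empType x = p ∧ (∀ j b, f j = some b → x j = b) ∧
        ∀ b, empType x b ≤ m * ((univ.filter fun j => f j = some b).card / n) := by
  choose R hR1 hR2 hR3 using fun x : Fin n → X => exists_restriction hm x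
  let F : Finset (Fin n → Option X) := univ.filter fun f : Fin n → Option X =>
      (univ.filter fun j => f j ≠ none).card ≤ n / m + Fintype.card X
  let φ : (Fin n → X) → (X → Fin (n + 1)) × (Fin n → Option X) := fun x =>
    (fun b => ⟨(univ.filter fun j => x j = b).card, Nat.lt_succ_of_le
      ((Finset.card_filter_le _ _).trans (by simp))⟩, R x)
  have hFne : F.Nonempty := ⟨fun _ => none, by simp [F]⟩
  obtain ⟨⟨d, f⟩, -, hf⟩ := Finset.exists_le_card_fiber_of_mul_le_card_of_maps_to
    (s := C) (t := univ ×ˢ F) (f := φ) (n := N)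
    (fun x _ => Finset.mem_product.2 ⟨Finset.mem_univ _, Finset.mem_filter.2
      ⟨Finset.mem_univ _, hR3 x⟩⟩) (Finset.univ_nonempty.product hFne)
    (by simpa [Finset.card_product] using hC)
  refine ⟨_, Finset.filter_subset _ _, hf, f, fun b => (d b : ℝ) / n, fun x hx => ?_⟩
  have hφ := (Finset.mem_filter.1 hx).2
  simp only [φ, Prod.mk.injEq] at hφ
  obtain ⟨h1, h2⟩ := hφ
  rw [← h2, ← h1]
  refine ⟨?_, hR1 x, fun b => ?_⟩
  · ext b
    simp [empType_apply]
  · rw [empType_apply, ← mul_div_assoc]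
    refine div_le_div_of_nonneg_right ?_ (by positivity)
    rw [Finset.sum_boole]
    exact_mod_cast hR2 x b

end Restrictions

/-- The constant `u` is chosen with `1 + d / u ≤ r`, and then `m` with `u ≤ r ^ m`. Two factors `r ^
n` cover the exponential terms and the third covers the polynomial and the constants. -/
theorem exists_growth_parameters (d : ℕ) {r : ℝ} (hr : 1 < r) :
    ∃ u : ℝ, 1 ≤ u ∧ ∃ m : ℕ, 2 ≤ m ∧ ∀ N : ℕ, ∀ᶠ n : ℕ in atTop,
      ((n : ℝ) + 1) ^ d * (u ^ (n / m + d) * (1 + d / u) ^ n) * N ≤ r ^ (3 * n) := by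
  obtain ⟨u, hu⟩ := exists_nat_gt (max 1 (d / (r - 1)))
  have hu1 : (1 : ℝ) ≤ u := (le_max_left _ _).trans hu.le
  have hu0 : (0 : ℝ) < u := by linarith
  have hdu : 1 + d / (u : ℝ) ≤ r := by
    have h := (le_max_right 1 (d / (r - 1))).trans hu.le
    rw [div_le_iff₀ (by linarith)] at h
    have : d / (u : ℝ) ≤ r - 1 := by
      rw [div_le_iff₀ hu0]
      linarith
    linarith
  obtain ⟨m, hm⟩ := pow_unbounded_of_one_lt (u : ℝ) hr
  refine ⟨u, hu1, m + 2, by omega, fun N => ?_⟩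
  have hum : (u : ℝ) ≤ r ^ (m + 2) := hm.le.trans (pow_le_pow_right₀ hr.le (by omega))
  have hlim := (tendsto_pow_const_div_const_pow_of_one_lt d hr).const_mul
    (2 ^ d * (u : ℝ) ^ d * N)
  rw [mul_zero] at hlim
  filter_upwards [hlim.eventually (gt_mem_nhds one_pos), eventually_ge_atTop 1] with n hn hn1
  have hrn : 0 < r ^ n := by positivity
  have h1 : 2 ^ d * (u : ℝ) ^ d * N * (n : ℝ) ^ d ≤ r ^ n := by
    rw [← mul_div_assoc, div_lt_one hrn] at hn
    exact hn.le
  have hn1' : (1 : ℝ) ≤ n := by exact_mod_cast hn1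
  have h2 : ((n : ℝ) + 1) ^ d ≤ 2 ^ d * (n : ℝ) ^ d := by
    rw [← mul_pow]
    exact pow_le_pow_left₀ (by positivity) (by linarith) d
  have h3 : (u : ℝ) ^ (n / (m + 2)) ≤ r ^ n := by
    calc (u : ℝ) ^ (n / (m + 2)) ≤ (r ^ (m + 2)) ^ (n / (m + 2)) :=
          pow_le_pow_left₀ hu0.le hum _
      _ = r ^ ((m + 2) * (n / (m + 2))) := (pow_mul _ _ _).symm
      _ ≤ r ^ n := pow_le_pow_right₀ hr.le (Nat.mul_div_le _ _)
  have h4 : (1 + d / (u : ℝ)) ^ n ≤ r ^ n := pow_le_pow_left₀ (by positivity) hdu n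
  calc ((n : ℝ) + 1) ^ d * ((u : ℝ) ^ (n / (m + 2) + d) * (1 + d / (u : ℝ)) ^ n) * N
      ≤ (2 ^ d * (n : ℝ) ^ d) * ((r ^ n * (u : ℝ) ^ d) * r ^ n) * N := by
        rw [pow_add]
        gcongr
    _ = (2 ^ d * (u : ℝ) ^ d * N * (n : ℝ) ^ d) * (r ^ n * r ^ n) := by ring
    _ ≤ r ^ n * (r ^ n * r ^ n) := by gcongr
    _ = r ^ (3 * n) := by ring

/-! ### Ramsey extraction of equicoupled sequences. -/

section Subsequences

/-- A large code contains a long sequence of distinct words all of whose increasing tuples have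
nearly the same joint type. -/
theorem exists_equicoupled_sequence (X : Type*) [Fintype X] (L M : ℕ) {ζ : ℝ} (hζ : 0 < ζ) :
    ∃ N : ℕ, ∀ (n : ℕ) (C : Finset (Fin n → X)), 0 < n → N ≤ C.card →
      ∃ c : ℕ → Fin n → X, (∀ k, c k ∈ C) ∧ (∀ k < M, ∀ l < M, c k = c l → k = l) ∧
        ∀ s t : Fin L → ℕ, StrictMono s → StrictMono t → (∀ i, s i < M) → (∀ i, t i < M) →
          savNorm (fun x => jointType (fun i => c (s i)) x - jointType (fun i => c (t i)) x)
            ≤ ζ := by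
  classical
  obtain ⟨G, hG⟩ := exists_nat_gt ((Fintype.card (Fin L → X) : ℝ) / ζ)
  have hG0 : (0 : ℝ) < G := lt_of_le_of_lt (by positivity) hG
  obtain ⟨N, hN⟩ := exists_ramsey_bound L ((Fin L → X) → Fin (G + 1)) (M + 1)
  refine ⟨N + 1, fun n C hn hcard => ?_⟩
  let e := C.equivFin
  let w : ℕ → Fin n → X := fun k => if hk : k < C.card then (e.symm ⟨k, hk⟩).1 else
    (e.symm ⟨0, by omega⟩).1
  have hwC : ∀ k, w k ∈ C := by
    intro k
    simp only [w]
    split_ifs <;> exact Subtype.coe_prop _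
  have hcell : ∀ (v : Fin L → Fin n → X) a, ⌊G * jointType v a⌋₊ < G + 1 := by
    intro v a
    refine Nat.lt_succ_of_le (Nat.floor_le_of_le ?_)
    have h1 := empType_mem_stdSimplex hn fun j i => v i j
    have h2 : jointType v a ≤ 1 := by
      rw [← h1.2]
      exact Finset.single_le_sum (fun b _ => h1.1 b) (Finset.mem_univ a)
    exact mul_le_of_le_one_right hG0.le h2
  -- The colour of an increasing tuple is its joint type rounded down to multiples of `1 / G`; equal
  -- colours force a distance of at most `card (Fin L → X) / G < ζ`.
  let cell : (Fin L → Fin n → X) → (Fin L → X) → Fin (G + 1) := fun v a =>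
    ⟨⌊G * jointType v a⌋₊, hcell v a⟩
  have hclose : ∀ v v', cell v = cell v' →
      savNorm (fun x => jointType v x - jointType v' x) ≤ ζ := by
    intro v v' h
    have h1 : ∀ a, |jointType v a - jointType v' a| ≤ (G : ℝ)⁻¹ := by
      intro a
      have h2 : ⌊G * jointType v a⌋₊ = ⌊G * jointType v' a⌋₊ := congrArg Fin.val (congrFun h a)
      have h3 : ∀ v : Fin L → Fin n → X, 0 ≤ G * jointType v a := fun v =>
        mul_nonneg hG0.le (empType_nonneg _ _)
      have h4 := Nat.floor_le (h3 v)
      have h5 := Nat.floor_le (h3 v')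
      have h6 := Nat.lt_floor_add_one (G * jointType v a)
      have h7 := Nat.lt_floor_add_one (G * jointType v' a)
      rw [h2] at h4 h6
      rw [← mul_le_mul_iff_right₀ hG0, mul_inv_cancel₀ hG0.ne', ← abs_of_pos hG0, ← abs_mul,
        abs_le, mul_sub]
      constructor <;> linarith
    refine (Finset.sum_le_sum fun a _ => h1 a).trans ?_
    rw [Finset.sum_const, Finset.card_univ, nsmul_eq_mul, ← div_eq_mul_inv, div_le_iff₀ hG0]
    rw [div_lt_iff₀ hζ] at hG
    linarith
  obtain ⟨t, htr, ht, d, hd⟩ := hN (Finset.range C.card)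
    (fun u => if hu : u.card = L then cell fun i => w (u.orderEmbOfFin hu i) else fun _ => 0)
    (by rw [Finset.card_range]; omega)
  have hord : StrictMono (t.orderEmbOfFin ht) := (t.orderEmbOfFin ht).strictMono
  -- Indices are read modulo `M + 1`, so that `c` is total; the extra point makes this meaningful
  -- also for `M = 0`.
  let c : ℕ → Fin n → X := fun k => w (t.orderEmbOfFin ht (Fin.ofNat (M + 1) k))
  have hof : ∀ k < M, ∀ l < M, k < l → Fin.ofNat (M + 1) k < Fin.ofNat (M + 1) l := by
    intro k hk l hl hkl
    rw [Fin.lt_def, Fin.val_ofNat, Fin.val_ofNat, Nat.mod_eq_of_lt (by omega),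
      Nat.mod_eq_of_lt (by omega)]
    exact hkl
  have hcol : ∀ s : Fin L → ℕ, StrictMono s → (∀ i, s i < M) →
      cell (fun i => c (s i)) = d := by
    intro s hs hsM
    let o : Fin L → ℕ := fun i => t.orderEmbOfFin ht (Fin.ofNat (M + 1) (s i))
    have ho : StrictMono o := fun i k hik => hord (hof _ (hsM i) _ (hsM k) (hs hik))
    have hcard' : (univ.image o).card = L := by
      rw [Finset.card_image_of_injective _ ho.injective]
      simp
    have h1 := hd (univ.image o) (fun b hb => by
      obtain ⟨i, -, rfl⟩ := Finset.mem_image.1 hb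
      exact Finset.orderEmbOfFin_mem t ht _) hcard'
    rw [dif_pos hcard'] at h1
    have h2 : o = (univ.image o).orderEmbOfFin hcard' :=
      Finset.orderEmbOfFin_unique hcard' (fun i => by simp) ho
    rw [← h1]
    congr 1
    ext1 i
    exact congrArg w (congrFun h2 i)
  refine ⟨c, fun k => hwC _, fun k hk l hl hkl => ?_, fun s t hs ht' hsM htM => hclose _ _ ?_⟩
  · by_contra hne
    have hlt : ∀ b, t.orderEmbOfFin ht b < C.card := fun b =>
      Finset.mem_range.1 (htr (Finset.orderEmbOfFin_mem t ht b))
    simp only [c, w, dif_pos (hlt _)] at hkl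
    have h1 := (t.orderEmbOfFin ht).injective
      (Fin.mk.inj_iff.1 (e.symm.injective (Subtype.ext hkl)))
    rcases lt_or_gt_of_ne hne with h | h
    · exact (hof k hk l hl h).ne h1
    · exact (hof l hl k hk h).ne' h1
  · rw [hcol s hs hsM, hcol t ht' htM]

end Subsequences

/-! ### Splitting off a diagonal law. -/

section DiagonalPart

variable {X : Type*}

theorem diagLaw_eq_sum [Fintype X] [DecidableEq X] {L : ℕ} (p : X → ℝ) :
    diagLaw L p = ∑ x, p x • tensorPow L (Pi.single x 1) := by
  ext a
  rw [diagLaw, marginal_apply, Finset.sum_apply]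
  refine Finset.sum_congr rfl fun x _ => ?_
  simp only [Pi.smul_apply, smul_eq_mul, tensorPow, Pi.single_apply]
  rw [Finset.prod_ite_zero]
  simp [funext_iff, eq_comm]

theorem marginal_diagLaw [Fintype X] {L : ℕ} (p : X → ℝ) (i : Fin L) :
    marginal (fun a => a i) (diagLaw L p) = p := by
  classical
  rw [diagLaw_eq_sum, marginal_sum]
  simp only [marginal_smul]
  ext y
  rw [Finset.sum_apply, Finset.sum_congr rfl fun x _ => by
    rw [marginal_tensorPow (by simp) i]]
  simp [Pi.single_apply]

theorem IsCP.nonneg {L : ℕ} {T : (Fin L → X) → ℝ} (hT : IsCP T) (a : Fin L → X) : 0 ≤ T a := by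
  obtain ⟨r, -, p, hp, hT⟩ := hT
  rw [hT]
  exact Finset.sum_nonneg fun j _ => Finset.prod_nonneg fun i _ => hp j _

variable {n : ℕ}

theorem sum_empType_block (c : ℕ → Fin n → X) {K : ℕ} (hK : 0 < K) {p : X → ℝ}
    (hc : ∀ k, empType (c k) = p) : ∑ j, (n : ℝ)⁻¹ • blockLaw c K 0 j = p := by
  classical
  have hK0 : (K : ℝ) ≠ 0 := by exact_mod_cast hK.ne'
  ext x
  simp only [Finset.sum_apply, Pi.smul_apply, smul_eq_mul, blockLaw, empType_apply, zero_mul,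
    zero_add, ← Finset.mul_sum, ← Finset.sum_div]
  rw [Finset.sum_comm]
  have h : ∀ k : Fin K, ∑ j, (if c k j = x then (1 : ℝ) else 0) / n = p x := fun k => by
    rw [← Finset.sum_div, ← empType_apply, hc]
  rw [← mul_div_assoc, Finset.mul_sum, Finset.sum_congr rfl fun k _ => by
    rw [← div_eq_inv_mul, Finset.sum_div, h k]]
  simp [hK0]

variable [Fintype X]

theorem marginal_columnMixture (c : ℕ → Fin n → X) {K : ℕ} (hK : 0 < K) {p : X → ℝ}
    (hc : ∀ k, empType (c k) = p) {L : ℕ} (i : Fin L) :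
    marginal (fun a => a i) (columnMixture L K c) = p := by
  rw [columnMixture, marginal_sum]
  simp only [marginal_smul]
  rw [Finset.sum_congr rfl fun j _ => by
    rw [marginal_tensorPow (blockLaw_mem_stdSimplex c hK 0 j).2 i]]
  exact sum_empType_block c hK hc

/-- If the words have a common restriction that contains at least the fraction `α` of the
occurrences of each letter, then the column mixture splits into `α` times the diagonal law and
`1 - α` times a completely positive self-coupling. -/
theorem exists_columnMixture_eq (c : ℕ → Fin n → X) (hn : 0 < n) {K : ℕ} (hK : 0 < K)
    [DecidableEq X] {p : X → ℝ} (hc : ∀ k, empType (c k) = p) {L : ℕ} (hL : 0 < L) {α : ℝ}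
    (hα1 : α < 1) {f : Fin n → Option X} (hf : ∀ k j b, f j = some b → c k j = b)
    (hfα : ∀ b, α * p b ≤ (univ.filter fun j => f j = some b).card / n) :
    ∃ U ∈ cpSelfCouplings L p, ∀ a,
      columnMixture L K c a = α * diagLaw L p a + (1 - α) * U a := by
  have hp : p ∈ stdSimplex ℝ X := hc 0 ▸ empType_mem_stdSimplex hn (c 0)
  have hα' : 0 < 1 - α := by linarith
  have hblock : ∀ j b, f j = some b → blockLaw c K 0 j = Pi.single b 1 := by
    intro j b hj
    have hK0 : (K : ℝ) ≠ 0 := by exact_mod_cast hK.ne'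
    ext x
    simp only [blockLaw, empType_apply, hf _ j b hj, Pi.single_apply, eq_comm (a := x)]
    split_ifs <;> simp [hK0]
  -- At a position fixed by `f` the column law is a point mass, so these positions contribute
  -- diagonal mass at each `b` in excess of `α * p b`. All coefficients that remain are nonnegative.
  have hsplit : columnMixture L K c - α • diagLaw L p
      = ∑ j with f j = none, (n : ℝ)⁻¹ • tensorPow L (blockLaw c K 0 j)
        + ∑ b, ((univ.filter fun j => f j = some b).card / n - α * p b) •
          tensorPow L (Pi.single b 1) := by
    have h1 : columnMixture L K c = ∑ j with f j = none, (n : ℝ)⁻¹ • tensorPow L (blockLaw c K 0 j)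
        + ∑ b, ∑ j with f j = some b, (n : ℝ)⁻¹ • tensorPow L (blockLaw c K 0 j) := by
      rw [columnMixture, ← Finset.sum_fiberwise_of_maps_to (t := univ) (g := f)
        fun _ _ => Finset.mem_univ _, Fintype.sum_option]
    rw [h1, diagLaw_eq_sum, Finset.smul_sum, add_sub_assoc, ← Finset.sum_sub_distrib]
    congr 1
    refine Finset.sum_congr rfl fun b _ => ?_
    rw [Finset.sum_congr rfl fun j hj => by rw [hblock j b (Finset.mem_filter.1 hj).2],
      Finset.sum_const, sub_smul, smul_smul, ← Nat.cast_smul_eq_nsmul ℝ, smul_smul, div_eq_mul_inv]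
  have hCP : IsCP (columnMixture L K c - α • diagLaw L p) := by
    rw [hsplit]
    refine (isCP_sum hL.ne' _ fun j _ => IsCP.smul hL.ne'
      (isCP_tensorPow (blockLaw_mem_stdSimplex c hK 0 j).1) (by positivity)).add
      (isCP_sum hL.ne' _ fun b _ => IsCP.smul hL.ne' (isCP_tensorPow fun x => ?_)
        (sub_nonneg.2 (hfα b)))
    rw [Pi.single_apply]
    split_ifs <;> simp
  have hCP' := IsCP.smul hL.ne' hCP (inv_nonneg.2 hα'.le)
  have hmarg : ∀ i : Fin L, marginal (fun a => a i)
      ((1 - α)⁻¹ • (columnMixture L K c - α • diagLaw L p)) = p := by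
    intro i
    rw [marginal_smul, sub_eq_add_neg (columnMixture L K c), ← neg_smul, marginal_add, marginal_smul,
      marginal_columnMixture c hK hc, marginal_diagLaw]
    ext x
    simp only [Pi.smul_apply, Pi.add_apply, smul_eq_mul]
    field_simp
    ring
  refine ⟨_, ⟨⟨⟨hCP'.nonneg, ?_⟩, hmarg⟩, hCP'⟩, fun a => ?_⟩
  · rw [← sum_marginal (fun a : Fin L → X => a ⟨0, hL⟩), hmarg, hp.2]
  · simp only [Pi.smul_apply, Pi.sub_apply, smul_eq_mul]
    field_simp
    ring

end DiagonalPart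

/-! ### Vanishing of the capacity. -/

section Capacity

variable {X S Y : Type*} [Fintype X] [Fintype S] [Fintype Y]

theorem HasInteriorInFace.exists_interior_point {Q : Set (S → ℝ)} (h : HasInteriorInFace Q)
    (hQ : Q ⊆ stdSimplex ℝ S) :
    ∃ q ∈ Q, (∀ p ∈ Q, ∀ a, q a = 0 → p a = 0) ∧ ∃ ε : ℝ, 0 < ε ∧ (∀ a, q a ≠ 0 → ε ≤ q a) ∧
      ∀ p ∈ stdSimplex ℝ S, (∀ a, q a = 0 → p a = 0) → (∀ a, |p a - q a| ≤ ε) → p ∈ Q := by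
  classical
  obtain ⟨q, hq, hmax, ε, hε, hball⟩ := h
  have hne : (univ.filter fun a => q a ≠ 0).Nonempty := by
    obtain ⟨a, -, ha⟩ := Finset.exists_ne_zero_of_sum_ne_zero
      (show ∑ a, q a ≠ 0 by rw [(hQ hq).2]; exact one_ne_zero)
    exact ⟨a, by simp [ha]⟩
  obtain ⟨a₀, ha₀, hmin⟩ := Finset.exists_min_image _ q hne
  have hpos : 0 < q a₀ := lt_of_le_of_ne ((hQ hq).1 a₀) (Finset.mem_filter.1 ha₀).2.symm
  refine ⟨q, hq, hmax, min ε (q a₀), lt_min hε hpos, fun a ha => (min_le_right _ _).trans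
    (hmin a (by simp [ha])), fun p hp hs hn => hball p hp hs fun a => (hn a).trans
      (min_le_left _ _)⟩

variable {L : ℕ}

/-- For some fixed `N`, every long code of `N` words of one admissible type that agree on a given
fraction of the occurrences of each letter contains confusable words. -/
theorem exists_confusable_of_common_restriction (A : Channel X S Y) [DecidableEq X]
    (hnoise : HasInteriorInFace A.noise) (hL : 2 ≤ L)
    (hcp : ∀ Px ∈ A.inp, cpSelfCouplings L Px ⊆ A.confusabilitySet L Px) {m : ℕ} (hm : 2 ≤ m) :
    ∃ N : ℕ, ∀ᶠ n : ℕ in atTop, ∀ C : Finset (Fin n → X), N ≤ C.card →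
      ∀ (f : Fin n → Option X), ∀ p ∈ A.inp, (∀ x ∈ C, empType x = p ∧
        (∀ j b, f j = some b → x j = b) ∧
        ∀ b, empType x b ≤ m * ((univ.filter fun j => f j = some b).card / n)) →
      ¬ A.IsListDecodable L C := by
  obtain ⟨q, hq, hmax, ε, hε, hεq, hball⟩ := hnoise.exists_interior_point A.noise_subset
  have hm0 : (0 : ℝ) < m := by positivity
  have hm1 : (m : ℝ)⁻¹ < 1 := inv_lt_one_of_one_lt₀ (by exact_mod_cast hm)
  let D : ℝ := Fintype.card (Fin L → X)
  have hD : 0 ≤ D := Nat.cast_nonneg _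
  let B : ℝ := D * (Fintype.card (Fin L → S) : ℝ) ^ 2
  -- The slack `α * ε` with `α = 1 / m` is halved: one half for the `D` entrywise errors of the
  -- joint type, the other for the rounding error `B / n`.
  have hδ : 0 < (m : ℝ)⁻¹ * ε / (2 * (D + 1)) := by positivity
  obtain ⟨ζ, η, K, hζ, hη, hK, hζη, hlt⟩ := exists_approximation_parameters L hδ
  obtain ⟨N, hN⟩ := exists_equicoupled_sequence X L (L * K + L) hζ
  refine ⟨N, ?_⟩
  have hlim : Tendsto (fun n : ℕ => B / (n : ℝ)) atTop (nhds 0) :=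
    tendsto_const_div_atTop_nhds_zero_nat B
  filter_upwards [hlim.eventually (gt_mem_nhds (show 0 < (m : ℝ)⁻¹ * ε / 2 by positivity)),
    eventually_gt_atTop 0] with n hB hn C hcard f p hp hC hdec
  obtain ⟨c, hcC, hinj, hnear⟩ := hN n C hn hcard
  have hps := A.inp_subset hp
  have hlast : ∀ i : Fin L, (i : ℕ) < L * K + L := fun i => by omega
  let v : Fin L → Fin n → X := fun i => c i
  -- The joint type of the first `L` words itself serves as the reference law `P`.
  have happ := abs_sub_columnMixture_le hn hL hK c (P := jointType v)
    (empType_mem_stdSimplex hn _) hη hζη fun t ht htl =>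
      hnear t (fun i => i) ht (fun i k hik => hik) htl hlast
  obtain ⟨U, hU, hTU⟩ := exists_columnMixture_eq c hn hK (fun k => (hC _ (hcC k)).1)
    (L := L) (by omega) hm1 (fun k => (hC _ (hcC k)).2.1) fun b => by
      have h := (hC _ (hcC 0)).2.2 b
      rw [(hC _ (hcC 0)).1] at h
      rwa [inv_mul_le_iff₀ hm0]
  refine hdec v (fun i k hik => Fin.ext (hinj i (hlast i) k (hlast k) hik)) (fun i => hcC i) ?_
  refine confusableWords_of_near A hq hmax hball hεq (inv_pos.2 hm0) hm1.le hps
    (hcp p hp ⟨tensorPow_mem_selfCouplings L hps, isCP_tensorPow hps.1⟩).2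
    (hcp p hp hU).2 hn v (fun i => (hC _ (hcC i)).1) ?_
  have h1 : savNorm (fun a => jointType v a - ((m : ℝ)⁻¹ * diagLaw L p a
      + (1 - (m : ℝ)⁻¹) * U a)) ≤ (m : ℝ)⁻¹ * ε / 2 := by
    refine (Finset.sum_le_sum (g := fun _ => (m : ℝ)⁻¹ * ε / (2 * (D + 1))) fun a _ => ?_).trans ?_
    · dsimp only
      rw [← hTU]
      exact (happ a).trans hlt.le
    · rw [Finset.sum_const, Finset.card_univ, nsmul_eq_mul]
      change D * _ ≤ _
      rw [← mul_div_assoc, div_le_div_iff₀ (by positivity) (by positivity)]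
      have : 0 < (m : ℝ)⁻¹ * ε := by positivity
      nlinarith
  have h2 : Fintype.card (Fin L → X) * (Fintype.card (Fin L → S) : ℝ) ^ 2 / n
      < (m : ℝ)⁻¹ * ε / 2 := hB
  linarith

/-- A code of rate above `ε` has more than `2 ^ (ε * n) = r ^ (3 * n)` words, which eventually
exceeds the number of pairs of a type and a restriction times any constant. -/
theorem eventually_rate_le (A : Channel X S Y) (hnoise : HasInteriorInFace A.noise) (hL : 2 ≤ L)
    (hcp : ∀ Px ∈ A.inp, cpSelfCouplings L Px ⊆ A.confusabilitySet L Px) {ε : ℝ} (hε : 0 < ε) :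
    ∀ᶠ n : ℕ in atTop, ∀ C : Finset (Fin n → X), (C : Set (Fin n → X)) ⊆ A.inputWords n →
      A.IsListDecodable L C → rate C ≤ ε := by
  classical
  let r : ℝ := 2 ^ (ε / 3)
  have hr : 1 < r := Real.one_lt_rpow one_lt_two (by positivity)
  obtain ⟨u, hu, m, hm, hgrowth⟩ := exists_growth_parameters (Fintype.card X) hr
  obtain ⟨N, hN⟩ := exists_confusable_of_common_restriction A hnoise hL hcp hm
  filter_upwards [hN, hgrowth (N + 1), eventually_gt_atTop 0] with n hconf hn hn0 C hCinp hdec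
  by_contra! hrate
  have hn0' : (0 : ℝ) < n := by exact_mod_cast hn0
  rw [rate, lt_div_iff₀ hn0'] at hrate
  have hCpos : (0 : ℝ) < C.card := by
    rcases Nat.eq_zero_or_pos C.card with h | h
    · rw [h, Nat.cast_zero, Real.logb_zero] at hrate
      exact absurd hrate (not_lt.2 (by positivity))
    · exact_mod_cast h
  have hsize : r ^ (3 * n) < C.card := by
    rw [Real.lt_logb_iff_rpow_lt one_lt_two hCpos] at hrate
    convert hrate using 1
    rw [← Real.rpow_natCast, ← Real.rpow_mul zero_le_two]
    congr 1
    push_cast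
    ring
  have hpartial := card_partial_functions_le (X := X) n (n / m + Fintype.card X) hu
  -- The size `N + 1` makes the subcode nonempty, so that its common type `p` is admissible.
  obtain ⟨C', hC', hcard, f, p, hp⟩ := exists_constant_type_subcode (m := m) (N := N + 1)
    (by omega) C (by
      have h : (((n + 1) ^ Fintype.card X * ((univ.filter fun f : Fin n → Option X =>
          (univ.filter fun j => f j ≠ none).card ≤ n / m + Fintype.card X).card) * (N + 1) : ℕ) : ℝ)
          ≤ C.card := by
        refine le_trans ?_ (hn.trans hsize.le)
        push_cast
        gcongr
      exact_mod_cast h)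
  obtain ⟨x, hx⟩ := Finset.card_pos.1 (show 0 < C'.card by omega)
  have hpinp : p ∈ A.inp := by
    rw [← (hp x hx).1]
    exact hCinp (hC' hx)
  exact hconf C' (by omega) f p hpinp hp fun v hv hvC => hdec v hv fun i => hC' (hvC i)

theorem capacity_eq_zero (A : Channel X S Y) (hnoise : HasInteriorInFace A.noise) (hL : 2 ≤ L)
    (hcp : ∀ Px ∈ A.inp, cpSelfCouplings L Px ⊆ A.confusabilitySet L Px) :
    A.capacity L = 0 := by
  unfold Channel.capacity
  refine Tendsto.limsup_eq (tendsto_order.2 ⟨fun b hb => ?_, fun b hb => ?_⟩)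
  · refine Eventually.of_forall fun n => hb.trans_le (Real.iSup_nonneg fun C => ?_)
    refine div_nonneg ?_ (Nat.cast_nonneg n)
    rcases Nat.eq_zero_or_pos C.1.card with h | h
    · simp [h]
    · exact Real.logb_nonneg one_lt_two (by exact_mod_cast h)
  · filter_upwards [eventually_rate_le A hnoise hL hcp (half_pos hb)] with n hn
    have h2 : b / 2 < b := half_lt_self hb
    refine lt_of_le_of_lt (Real.iSup_le (fun C => ?_) (half_pos hb).le) h2
    exact hn C.1 C.2.1 C.2.2

end Capacity

end

end ListDecoding

/-! ### The converse. -/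

theorem mainTheorem1 {X S Y : Type*} [Fintype X] [Fintype S] [Fintype Y]
    (A : ListDecoding.Channel X S Y)
    (hnoise : ListDecoding.HasInteriorInFace A.noise)
    (L : ℕ) (hL : 2 ≤ L)
    (hcp : ∀ Px ∈ A.inp, ListDecoding.cpSelfCouplings L Px ⊆ A.confusabilitySet L Px) :
    A.capacity L = 0 ∧
    (∀ Px ∈ A.inp, ∀ P ∈ ListDecoding.selfCouplings L Px \ A.confusabilitySet L Px,
      ∃ ζ : ℝ, 0 < ζ ∧ ∃ N : ℕ, ∀ (n : ℕ) (C : Finset (Fin n → X)),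
        ListDecoding.IsEquicoupled ζ P C → A.IsListDecodable L C → C.card ≤ N) ∧
    (∀ Px ∈ A.inp,
      (∃ ρ : ℝ, 0 < ρ ∧ ∀ P ∈ ListDecoding.cpSelfCouplings L Px,
        ∀ P' ∈ ListDecoding.selfCouplings L Px \ A.confusabilitySet L Px,
          ρ ≤ ListDecoding.savNorm (fun x => P x - P' x)) →
      ∃ ζ : ℝ, 0 < ζ ∧ ∃ N : ℕ,
        ∀ P ∈ ListDecoding.selfCouplings L Px \ A.confusabilitySet L Px,
          ∀ (n : ℕ) (C : Finset (Fin n → X)),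
            ListDecoding.IsEquicoupled ζ P C → A.IsListDecodable L C → C.card ≤ N) := by
  refine ⟨ListDecoding.capacity_eq_zero A hnoise hL hcp, fun Px hPx P hP => ?_,
    fun Px hPx ⟨ρ, hρ, hdist⟩ => ?_⟩
  · obtain ⟨ζ, hζ, N, h⟩ := ListDecoding.exists_card_bound_of_not_isCP hL hP.1.1
      fun hc => hP.2 (hcp Px hPx ⟨hP.1, hc⟩)
    exact ⟨ζ, hζ, N, fun n C hC _ => h n C hC⟩
  · obtain ⟨ζ, hζ, N, h⟩ := ListDecoding.exists_card_bound_of_distance hL Px hρ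
    exact ⟨ζ, hζ, N, fun P hP n C hC _ => h P hP.1 (fun Q hQ => hdist Q hQ P hP) n C hC⟩
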